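/- Let $\mathbb{H}$ be the upper half-plane and, for $\tau\in\mathbb{H}$ and $r\in\mathbb{Q}$, put $q^r=e^{2\pi i r\tau}$. For $\mathbf{a}=(a_1,a_2)\in\mathbb{Q}^2\setminus\mathbb{Z}^2$ let $g_{\mathbf{a}}:\mathbb{H}\to\mathbb{C}$ be the Siegel function $$g_{\mathbf{a}}(\tau)=-q^{B_2(a_1)/2}\,e^{\pi i a_2(a_1-1)}\prod_{n=0}^{\infty}\left(1-q^{n+a_1}e^{2\pi i a_2}\right)\left(1-q^{n+1-a_1}e^{-2\pi i a_2}\right),\qquad B_2(T)=T^2-T+\tfrac16,$$ which is holomorphic and has no zeros on $\mathbb{H}$. Let $j=E_4^3/\Delta=q^{-1}+744+\cdots$ be the modular invariant, where $E_4$ is the Eisenstein series of weight $4$ and level $1$ with constant term $1$ and $\Delta=q\prod_{n\ge1}(1-q^n)^{24}$, and let $\mathbb{Z}[j]$ be the ring of polynomials in $j$ with integer coefficients, a subring of the ring of functions $\mathbb{H}\to\mathbb{C}$. Let $N$ be the denominator of $\mathbf{a}$, that is, the least common denominator of $a_1$ and $a_2$, and let $\zeta_N\in\mathbb{C}$ be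 any primitive $N$-th root of unity. **Proposition.** Both functions $g_{\mathbf{a}}$ and $(1-\zeta_N)\,g_{\mathbf{a}}^{-1}$ are integral over $\mathbb{Z}[j]$. -/

import Mathlib

open UpperHalfPlane

/-- The rational power `q^r = e^{2πirτ}` of `q = e^{2πiτ}`. -/
noncomputable def qPow (r : ℚ) (τ : ℍ) : ℂ :=
  Complex.exp (2 * Real.pi * Complex.I * (r : ℂ) * (τ : ℂ))

/-- The second Bernoulli polynomial `T² - T + 1/6`, evaluated at a rational number. -/
def bernoulliTwo (t : ℚ) : ℚ := t ^ 2 - t + 1 / 6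

/-- The `n`-th factor `(1 - q^{n+a₁} e^{2πia₂}) (1 - q^{n+1-a₁} e^{-2πia₂})` of the infinite product
for the Siegel function. -/
noncomputable def siegelFactor (a : ℚ × ℚ) (τ : ℍ) (n : ℕ) : ℂ :=
  (1 - qPow (n + a.1) τ * Complex.exp (2 * Real.pi * Complex.I * (a.2 : ℂ))) *
    (1 - qPow (n + 1 - a.1) τ * Complex.exp (-(2 * Real.pi * Complex.I * (a.2 : ℂ))))

/-- The Siegel function `g_a : ℍ → ℂ`, for `a = (a₁, a₂)` a pair of rational numbers. -/
noncomputable def siegelFunction (a : ℚ × ℚ) (τ : ℍ) : ℂ :=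
  -qPow (bernoulliTwo a.1 / 2) τ *
    Complex.exp (Real.pi * Complex.I * (a.2 : ℂ) * ((a.1 : ℂ) - 1)) *
    ∏' n : ℕ, siegelFactor a τ n

/-- The modular invariant `j = E₄³ / Δ = q⁻¹ + 744 + ⋯`. -/
noncomputable def modularJ (τ : ℍ) : ℂ :=
  ModularForm.E₄ τ ^ 3 / ModularForm.discriminant τ

/-- The denominator of `a = (a₁, a₂)`: the least common denominator of `a₁` and `a₂`. -/
def pairDenom (a : ℚ × ℚ) : ℕ := Nat.lcm a.1.den a.2.den

/-- The ring `ℤ[j]`, as a subring of the ring of all functions `ℍ → ℂ`. -/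
noncomputable def intAdjoinJ : Subalgebra ℤ (ℍ → ℂ) := Algebra.adjoin ℤ {modularJ}

lemma qPow_add (r s : ℚ) (τ : ℍ) : qPow (r + s) τ = qPow r τ * qPow s τ := by
  simp only [qPow, ← Complex.exp_add]
  congr 1
  push_cast
  ring

lemma norm_qPow_one_lt (τ : ℍ) : ‖qPow 1 τ‖ < 1 := by
  have := UpperHalfPlane.norm_exp_two_pi_I_lt_one τ
  simpa [qPow] using this

lemma qPow_nat (n : ℕ) (τ : ℍ) : qPow n τ = qPow 1 τ ^ n := by
  simp only [qPow, ← Complex.exp_nat_mul]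
  congr 1
  push_cast
  ring

lemma qPow_mul_exp_ne_one {r s : ℚ} (h : ¬ (r = 0 ∧ ∃ m : ℤ, s = m)) (τ : ℍ) :
    qPow r τ * Complex.exp (2 * Real.pi * Complex.I * (s : ℂ)) ≠ 1 := by
  rw [qPow, ← Complex.exp_add, Ne, Complex.exp_eq_one_iff]
  rintro ⟨m, hm⟩
  have h2 : (2 * Real.pi * Complex.I : ℂ) ≠ 0 := Complex.two_pi_I_ne_zero
  have h3 : (r : ℂ) * (τ : ℂ) + (s : ℂ) = m := by
    apply mul_left_cancel₀ h2
    linear_combination hm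
  have him := congrArg Complex.im h3
  have hr : r = 0 := by
    simpa [τ.im_ne_zero] using him
  refine h ⟨hr, m, ?_⟩
  subst hr
  have : (s : ℂ) = m := by simpa using h3
  exact_mod_cast this

lemma siegelFactor_ne_zero {a : ℚ × ℚ} (ha : ¬ ∃ m : ℤ × ℤ, a = ((m.1 : ℚ), (m.2 : ℚ)))
    (τ : ℍ) (n : ℕ) : siegelFactor a τ n ≠ 0 := by
  refine mul_ne_zero (sub_ne_zero.2 (Ne.symm ?_)) (sub_ne_zero.2 (Ne.symm ?_))
  · refine qPow_mul_exp_ne_one ?_ τ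
    rintro ⟨h1, m, hm⟩
    exact ha ⟨(-n, m), Prod.ext (by push_cast; linarith) hm⟩
  · have := @qPow_mul_exp_ne_one (n + 1 - a.1) (-a.2) ?_ τ
    · simpa using this
    rintro ⟨h1, m, hm⟩
    exact ha ⟨(n + 1, -m), Prod.ext (by push_cast; linarith) (by push_cast; linarith)⟩

lemma summable_siegelFactor_sub_one (a : ℚ × ℚ) (τ : ℍ) :
    Summable fun n => ‖siegelFactor a τ n - 1‖ := by
  set x := qPow a.1 τ * Complex.exp (2 * Real.pi * Complex.I * (a.2 : ℂ)) with hx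
  set y := qPow (1 - a.1) τ * Complex.exp (-(2 * Real.pi * Complex.I * (a.2 : ℂ))) with hy
  set q := qPow 1 τ with hq
  have hq1 : ‖q‖ < 1 := norm_qPow_one_lt τ
  have hfac : ∀ n, siegelFactor a τ n - 1 = -x * q ^ n + (-y) * q ^ n + x * y * (q ^ n * q ^ n) := by
    intro n
    have e1 : qPow (n + a.1) τ = q ^ n * qPow a.1 τ := by rw [qPow_add, qPow_nat]
    have e2 : qPow (n + 1 - a.1) τ = q ^ n * qPow (1 - a.1) τ := by
      rw [add_sub_assoc, qPow_add, qPow_nat]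
    rw [siegelFactor, e1, e2, hx, hy]
    ring
  have hg : Summable fun n : ℕ => ‖q‖ ^ n := summable_geometric_of_lt_one (norm_nonneg _) hq1
  refine Summable.of_nonneg_of_le (fun _ => norm_nonneg _) (fun n => ?_)
    (hg.mul_left (‖x‖ + ‖y‖ + ‖x‖ * ‖y‖))
  rw [hfac]
  have hqn : ‖q‖ ^ n ≤ 1 := pow_le_one₀ (norm_nonneg _) hq1.le
  have h0 : 0 ≤ ‖q‖ ^ n := by positivity
  calc _ ≤ ‖x‖ * ‖q‖ ^ n + ‖y‖ * ‖q‖ ^ n + ‖x‖ * ‖y‖ * (‖q‖ ^ n * ‖q‖ ^ n) := by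
        refine (norm_add₃_le).trans (le_of_eq ?_)
        simp [norm_mul, norm_pow]
    _ ≤ ‖x‖ * ‖q‖ ^ n + ‖y‖ * ‖q‖ ^ n + ‖x‖ * ‖y‖ * (‖q‖ ^ n * 1) := by gcongr
    _ = _ := by ring

/-- The infinite product defining the Siegel function converges. -/
theorem multipliable_siegelFactor (a : ℚ × ℚ) (τ : ℍ) : Multipliable (siegelFactor a τ) := by
  simpa using multipliable_one_add_of_summable (summable_siegelFactor_sub_one a τ)

/-- The Siegel function has no zeros on `ℍ`, so its pointwise reciprocal is its inverse. -/
theorem siegelFunction_ne_zero {a : ℚ × ℚ} (ha : ¬ ∃ m : ℤ × ℤ, a = ((m.1 : ℚ), (m.2 : ℚ)))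
    (τ : ℍ) : siegelFunction a τ ≠ 0 := by
  refine mul_ne_zero (mul_ne_zero (neg_ne_zero.2 (Complex.exp_ne_zero _)) (Complex.exp_ne_zero _)) ?_
  have := tprod_one_add_ne_zero_of_summable (f := fun n => siegelFactor a τ n - 1)
    (fun n => by simpa using siegelFactor_ne_zero ha τ n) (summable_siegelFactor_sub_one a τ)
  simpa using this

/-! Integrality may be checked on `12N`-th powers. The function `g_a ^ (12 * N)` depends only on the
class of `a` in `(N⁻¹ℤ/ℤ)²`, and `S` and `T` act on it by `(a₁, a₂) ↦ (a₂, -a₁)` and `(a₁, a₁ +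
a₂)`. So the powers attached to the elements of exact order `N` in `(ℤ/N)²` form a finite family
that `S` and `T` permute, and the coefficients of `∏ (X - h_b)` are invariant holomorphic functions.
Their expansions in `q^{1/N}` have algebraic integer coefficients. Subtracting multiples of powers
of `j` until no pole remains shows that they are polynomials in `j` over the algebraic integers
(`mem_of_invariant`), hence integral over `ℤ[j]`; `isIntegral_of_permuted` and transitivity finish.

The reciprocals are permuted in the same way. Their expansions are integral as well, unless `a₁` is
an integer: then a factor `1 - ξ` with `ξ` a root of unity has to be inverted. Exact order `N` makes
`ξ` a primitive `N`-th root of unity, so `(1 - ζ) / (1 - ξ)` is an algebraic integer, and the factor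
`1 - ζ` suffices.

The analytic input is the action of `S` (`thetaProd_neg_one_div`). The Siegel function is
essentially a theta product at `z = a₁τ + a₂`. After a Gaussian correction, the theta products for
`-1/t` and `t` have the same multipliers and zeros, so their ratio is an entire elliptic function,
thus constant; the transformation of `η` gives the twelfth power of the constant. -/

/-! ### The infinite product `∏ (1 - x qⁿ)`: estimates and holomorphy. -/

/-- The infinite `q`-Pochhammer symbol `∏ (1 - x qⁿ)`. -/
noncomputable def qProd (x q : ℂ) : ℂ := ∏' n : ℕ, (1 - x * q ^ n)

lemma summable_norm_mul_pow (x : ℂ) {q : ℂ} (hq : ‖q‖ < 1) :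
    Summable fun n : ℕ => ‖-(x * q ^ n)‖ := by
  simpa using (summable_geometric_of_lt_one (norm_nonneg _) hq).mul_left ‖x‖

lemma multipliable_qProd (x : ℂ) {q : ℂ} (hq : ‖q‖ < 1) :
    Multipliable fun n : ℕ => 1 - x * q ^ n := by
  simpa [sub_eq_add_neg] using multipliable_one_add_of_summable (summable_norm_mul_pow x hq)

lemma qProd_eq_mul (x : ℂ) {q : ℂ} (hq : ‖q‖ < 1) :
    qProd x q = (1 - x) * qProd (x * q) q := by
  have h := multipliable_qProd (x * q) hq
  have e : (fun n : ℕ => 1 - x * q * q ^ n) = fun n => 1 - x * q ^ (n + 1) := by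
    ext n; rw [pow_succ']; ring
  rw [qProd, tprod_eq_zero_mul' (by rwa [e] at h), qProd, e]
  simp

lemma qProd_eq_prod_mul (x : ℂ) {q : ℂ} (hq : ‖q‖ < 1) (k : ℕ) :
    qProd x q = (∏ i ∈ Finset.range k, (1 - x * q ^ i)) * qProd (x * q ^ k) q := by
  induction k with
  | zero => simp
  | succ k ih =>
    rw [ih, qProd_eq_mul _ hq, Finset.prod_range_succ, mul_assoc (x : ℂ), ← pow_succ, mul_assoc]

lemma qProd_ne_zero {x q : ℂ} (hq : ‖q‖ < 1) (h : ∀ n : ℕ, x * q ^ n ≠ 1) : qProd x q ≠ 0 := by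
  have := tprod_one_add_ne_zero_of_summable (f := fun n : ℕ => -(x * q ^ n))
    (fun n => by
      have := sub_ne_zero.2 (h n).symm
      rwa [sub_eq_add_neg] at this) (summable_norm_mul_pow x hq)
  simpa [qProd, sub_eq_add_neg] using this

/-- Finite products satisfy `‖∏ (1 + aₙ) - 1‖ ≤ exp (∑ ‖aₙ‖) - 1`, and here the sum is bounded by a
geometric series. The explicit bound later controls the tails of the product at `i∞`. -/
lemma norm_qProd_sub_one_le (x : ℂ) {q : ℂ} (hq : ‖q‖ < 1) :
    ‖qProd x q - 1‖ ≤ Real.exp (‖x‖ * (1 - ‖q‖)⁻¹) - 1 := by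
  have hs := summable_norm_mul_pow x hq
  have h := (multipliable_qProd x hq).hasProd
  refine le_of_tendsto (((h.sub_const 1)).norm) (Filter.Eventually.of_forall fun s => ?_)
  have h1 := s.norm_prod_one_add_sub_one_le (fun n : ℕ => -(x * q ^ n))
  simp only [← sub_eq_add_neg] at h1
  refine h1.trans (sub_le_sub_right (Real.exp_le_exp.2 ?_) _)
  refine (hs.sum_le_tsum s fun _ _ => norm_nonneg _).trans (le_of_eq ?_)
  simp [tsum_mul_left, tsum_geometric_of_lt_one (norm_nonneg q) hq]

/-- Near `t` the factors are dominated by a fixed geometric series, so the product converges locally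
uniformly. Both arguments vary, so that the lemma serves for theta products in `z` and for Siegel
functions in `τ`. -/
lemma differentiableAt_qProd {x q : ℂ → ℂ} {t : ℂ} {U : Set ℂ} (hU : U ∈ nhds t)
    (hx : DifferentiableOn ℂ x U) (hq : DifferentiableOn ℂ q U) (h : ‖q t‖ < 1) :
    DifferentiableAt ℂ (fun s => qProd (x s) (q s)) t := by
  obtain ⟨r, hr, hr1⟩ := exists_between h
  have hr0 : 0 ≤ r := (norm_nonneg _).trans hr.le
  have cx : ContinuousAt x t := (hx.differentiableAt hU).continuousAt
  have cq : ContinuousAt q t := (hq.differentiableAt hU).continuousAt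
  have e1 : ∀ᶠ s in nhds t, ‖q s‖ < r := cq.norm.eventually_lt_const hr
  have e2 : ∀ᶠ s in nhds t, ‖x s‖ < ‖x t‖ + 1 := cx.norm.eventually_lt_const (by simp)
  obtain ⟨V, hV, hVo, htV⟩ := eventually_nhds_iff.1 ((e1.and e2).and hU)
  have hxV : DifferentiableOn ℂ x V := hx.mono fun s hs => (hV s hs).2
  have hqV : DifferentiableOn ℂ q V := hq.mono fun s hs => (hV s hs).2
  have hp := Summable.hasProdLocallyUniformlyOn_one_add (K := V)
    (f := fun (n : ℕ) s => -(x s * q s ^ n)) (u := fun n => (‖x t‖ + 1) * r ^ n) hVo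
    ((summable_geometric_of_lt_one hr0 hr1).mul_left _)
    (Filter.Eventually.of_forall fun n s hs => by
      obtain ⟨⟨h1, h2⟩, -⟩ := hV s hs
      rw [norm_neg, norm_mul, norm_pow]
      gcongr)
    (fun n => (hxV.mul (hqV.pow n)).neg.continuousOn)
  have hd : DifferentiableOn ℂ (fun s => ∏' n : ℕ, (1 + -(x s * q s ^ n))) V := by
    refine hp.differentiableOn (.of_forall fun s => ?_) hVo
    simpa [Finset.prod_fn] using
      DifferentiableOn.finsetProd (fun n _ => (((hxV.mul (hqV.pow n)).neg).const_add 1))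
  simpa [qProd, sub_eq_add_neg] using hd.differentiableAt (hVo.mem_nhds htV)

/-! ### Entire functions with lattice multipliers. -/

/-- All values are taken on a compact period parallelogram, so Liouville's theorem applies. -/
lemma Function.Periodic.eq_of_periodic_of_differentiable {R : ℂ → ℂ} {t : ℂ} (ht : 0 < t.im)
    (h1 : Function.Periodic R 1) (h2 : Function.Periodic R t) (hR : Differentiable ℂ R)
    (z w : ℂ) : R z = R w := by
  refine hR.apply_eq_apply_of_bounded ?_ z w
  have hK : IsCompact ((fun p : ℝ × ℝ => (p.1 : ℂ) * t + p.2) ''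
      (Set.Icc (0 : ℝ) 1 ×ˢ Set.Icc (0 : ℝ) 1)) :=
    (isCompact_Icc.prod isCompact_Icc).image (by fun_prop)
  refine (hK.image hR.continuous).isBounded.subset ?_
  rintro _ ⟨z, rfl⟩
  set a : ℝ := z.im / t.im with ha
  set b : ℝ := z.re - a * t.re with hb
  have hz : z = a * t + b := by
    apply Complex.ext
    · simp [hb]
    · simp [ha, ht.ne']
  refine ⟨_, ⟨(Int.fract a, Int.fract b), ⟨⟨Int.fract_nonneg _, (Int.fract_lt_one _).le⟩,
    ⟨Int.fract_nonneg _, (Int.fract_lt_one _).le⟩⟩, rfl⟩, ?_⟩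
  have e : z = ((Int.fract a : ℝ) : ℂ) * t + (Int.fract b : ℝ) + (⌊a⌋ : ℂ) * t
      + (⌊b⌋ : ℂ) * 1 := by
    have h3 : (a : ℂ) = (⌊a⌋ : ℂ) + (Int.fract a : ℝ) := by
      exact_mod_cast (Int.floor_add_fract a).symm
    have h4 : (b : ℂ) = (⌊b⌋ : ℂ) + (Int.fract b : ℝ) := by
      exact_mod_cast (Int.floor_add_fract b).symm
    rw [hz]; linear_combination t * h3 + h4
  rw [e, h1.int_mul, h2.int_mul]

/-- Two entire functions with the same multipliers for a lattice are proportional, if the second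
has at most simple zeros, located at lattice points, and the first vanishes there as well. -/
lemma eq_const_mul_of_same_multipliers {F θ : ℂ → ℂ} {t : ℂ} (ht : 0 < t.im) {u v : ℂ → ℂ}
    (hF : Differentiable ℂ F) (hθ : Differentiable ℂ θ) (hu : ∀ z, u z ≠ 0) (hv : ∀ z, v z ≠ 0)
    (F1 : ∀ z, F (z + 1) = u z * F z) (θ1 : ∀ z, θ (z + 1) = u z * θ z)
    (F2 : ∀ z, F (z + t) = v z * F z) (θ2 : ∀ z, θ (z + t) = v z * θ z)
    (hz : ∀ z, θ z = 0 → ∃ m n : ℤ, z = m * t + n) (F0 : F 0 = 0) (θ0 : θ 0 = 0)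
    (hd : deriv θ 0 ≠ 0) (z : ℂ) : F z = deriv F 0 / deriv θ 0 * θ z := by
  classical
  set C := deriv F 0 / deriv θ 0 with hC
  -- At the zeros of `θ` the value `C` is the one that removes the singularity at `0`, and by
  -- periodicity at every lattice point.
  set R : ℂ → ℂ := fun z => if θ z = 0 then C else F z / θ z with hR
  have p1 : Function.Periodic R 1 := fun z => by
    simp only [hR, θ1, F1, mul_eq_zero, hu, false_or, mul_div_mul_left _ _ (hu z)]
  have p2 : Function.Periodic R t := fun z => by
    simp only [hR, θ2, F2, mul_eq_zero, hv, false_or, mul_div_mul_left _ _ (hv z)]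
  have dF : Differentiable ℂ (dslope F 0) := by
    rw [← differentiableOn_univ, Complex.differentiableOn_dslope Filter.univ_mem]
    exact hF.differentiableOn
  have dθ : Differentiable ℂ (dslope θ 0) := by
    rw [← differentiableOn_univ, Complex.differentiableOn_dslope Filter.univ_mem]
    exact hθ.differentiableOn
  have sF : ∀ w, F w = w * dslope F 0 w := fun w => by
    have := sub_smul_dslope F 0 w
    simpa [F0] using this.symm
  have sθ : ∀ w, θ w = w * dslope θ 0 w := fun w => by
    have := sub_smul_dslope θ 0 w
    simpa [θ0] using this.symm
  have R0 : DifferentiableAt ℂ R 0 := by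
    have hne : dslope θ 0 0 ≠ 0 := by simpa using hd
    refine ((dF 0).div (dθ 0) hne).congr_of_eventuallyEq ?_
    filter_upwards [(dθ 0).continuousAt.eventually_ne hne] with w hw
    rcases eq_or_ne w 0 with rfl | hw0
    · simp [hR, θ0, hC]
    · have : θ w ≠ 0 := by rw [sθ]; exact mul_ne_zero hw0 hw
      simp only [hR, this, if_false, Pi.div_apply]
      rw [sF, sθ, mul_div_mul_left _ _ hw0]
  have hRd : Differentiable ℂ R := fun z => by
    by_cases h : θ z = 0
    · obtain ⟨m, n, hmn⟩ := hz z h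
      -- A zero of `θ` is a lattice point, hence a period of `R`: differentiability there follows
      -- from that at `0`.
      have e : R = fun w => R (w - z) := by
        ext w
        have : w = w - z + m * t + n * 1 := by rw [hmn]; ring
        conv_lhs => rw [this]
        rw [p1.int_mul, p2.int_mul]
      rw [e]
      refine DifferentiableAt.comp z (g := R) (f := fun w => w - z) ?_ (by fun_prop)
      simpa using R0
    · refine ((hF z).div (hθ z) h).congr_of_eventuallyEq ?_
      filter_upwards [(hθ z).continuousAt.eventually_ne h] with w hw
      simp [hR, hw]
  have hc : ∀ z, R z = C := fun z => by
    rw [p1.eq_of_periodic_of_differentiable ht p2 hRd z 0]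
    simp [hR, θ0]
  by_cases h : θ z = 0
  · obtain ⟨m, n, hmn⟩ := hz z h
    have hFt : Function.Periodic (fun w => F w = 0) t := fun w => by simp [F2, hv]
    have hF1 : Function.Periodic (fun w => F w = 0) 1 := fun w => by simp [F1, hu]
    have : F (0 + m * t + n * 1) = 0 := by
      have h5 := hF1.int_mul n (0 + m * t)
      have h6 := hFt.int_mul m 0
      rw [h5, h6, F0]
    rw [h, hmn, mul_zero, ← this]; simp
  · have := hc z
    simp only [hR, h, if_false] at this
    rw [← this, div_mul_cancel₀ _ h]

/-! ### Theta products and their transformation under `t ↦ -1/t`. -/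

/-- The exponential `e^{2πiz}`. -/
noncomputable def expTwoPi (z : ℂ) : ℂ := Complex.exp (2 * Real.pi * Complex.I * z)

lemma expTwoPi_add (z w : ℂ) : expTwoPi (z + w) = expTwoPi z * expTwoPi w := by
  rw [expTwoPi, mul_add, Complex.exp_add]; rfl

lemma expTwoPi_ne_zero (z : ℂ) : expTwoPi z ≠ 0 := Complex.exp_ne_zero _

lemma expTwoPi_int (n : ℤ) : expTwoPi n = 1 :=
  Complex.exp_eq_one_iff.2 ⟨n, by ring⟩

lemma expTwoPi_one : expTwoPi 1 = 1 := by simpa using expTwoPi_int 1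

lemma expTwoPi_zero : expTwoPi 0 = 1 := by simp [expTwoPi]

lemma expTwoPi_natCast_mul (n : ℕ) (z : ℂ) : expTwoPi (n * z) = expTwoPi z ^ n := by
  rw [expTwoPi, expTwoPi, ← Complex.exp_nat_mul]; congr 1; ring

lemma expTwoPi_neg (z : ℂ) : expTwoPi (-z) = (expTwoPi z)⁻¹ := by
  rw [expTwoPi, expTwoPi, ← Complex.exp_neg]; congr 1; ring

lemma expTwoPi_eq_one_iff {z : ℂ} : expTwoPi z = 1 ↔ ∃ n : ℤ, z = n := by
  constructor
  · intro h
    obtain ⟨n, hn⟩ := Complex.exp_eq_one_iff.1 h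
    refine ⟨n, mul_left_cancel₀ Complex.two_pi_I_ne_zero ?_⟩
    rw [hn]; ring
  · rintro ⟨n, rfl⟩; exact expTwoPi_int n

lemma differentiable_expTwoPi : Differentiable ℂ expTwoPi := by
  unfold expTwoPi; fun_prop

lemma norm_expTwoPi_lt_one {t : ℂ} (ht : 0 < t.im) : ‖expTwoPi t‖ < 1 :=
  UpperHalfPlane.norm_exp_two_pi_I_lt_one ⟨t, ht⟩

/-- The theta function `(x^{-1/2} - x^{1/2}) ∏ (1 - x qⁿ) (1 - x⁻¹ qⁿ)`, `x = e^{2πiz}`,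
`q = e^{2πit}`, up to the factor `∏ (1 - qⁿ)`. -/
noncomputable def thetaProd (t z : ℂ) : ℂ :=
  expTwoPi (-z / 2) * qProd (expTwoPi z) (expTwoPi t) * qProd (expTwoPi (t - z)) (expTwoPi t)

/-- Splitting off the factor `n = 0` isolates the zero at the origin, from which the derivative
there is read off. -/
lemma thetaProd_eq {t : ℂ} (ht : 0 < t.im) (z : ℂ) : thetaProd t z = (1 - expTwoPi z) *
    (expTwoPi (-z / 2) * qProd (expTwoPi (t + z)) (expTwoPi t)
      * qProd (expTwoPi (t - z)) (expTwoPi t)) := by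
  rw [thetaProd, qProd_eq_mul _ (norm_expTwoPi_lt_one ht), ← expTwoPi_add, add_comm z t]
  ring

lemma thetaProd_zero {t : ℂ} (ht : 0 < t.im) : thetaProd t 0 = 0 := by
  simp [thetaProd_eq ht, expTwoPi_zero]

lemma differentiable_qProd_expTwoPi {t : ℂ} (ht : 0 < t.im) {f : ℂ → ℂ}
    (hf : Differentiable ℂ f) :
    Differentiable ℂ fun z => qProd (expTwoPi (f z)) (expTwoPi t) := fun z =>
  differentiableAt_qProd (x := fun z => expTwoPi (f z)) (q := fun _ => expTwoPi t) Filter.univ_mem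
    (differentiable_expTwoPi.comp hf).differentiableOn (by fun_prop) (norm_expTwoPi_lt_one ht)

lemma differentiable_thetaProd {t : ℂ} (ht : 0 < t.im) : Differentiable ℂ (thetaProd t) :=
  ((differentiable_expTwoPi.comp (by fun_prop : Differentiable ℂ fun z : ℂ => -z / 2)).mul
    (differentiable_qProd_expTwoPi ht differentiable_id)).mul
    (differentiable_qProd_expTwoPi ht (by fun_prop))

lemma deriv_thetaProd_zero {t : ℂ} (ht : 0 < t.im) : deriv (thetaProd t) 0 =
    -(2 * Real.pi * Complex.I) * qProd (expTwoPi t) (expTwoPi t) ^ 2 := by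
  set G : ℂ → ℂ := fun z => (expTwoPi (-z / 2) * qProd (expTwoPi (t + z)) (expTwoPi t)
      * qProd (expTwoPi (t - z)) (expTwoPi t)) with hG
  have hGd : Differentiable ℂ G :=
    ((differentiable_expTwoPi.comp (by fun_prop : Differentiable ℂ fun z : ℂ => -z / 2)).mul
      (differentiable_qProd_expTwoPi ht (by fun_prop))).mul
      (differentiable_qProd_expTwoPi ht (by fun_prop))
  have e : thetaProd t = fun z => (1 - expTwoPi z) * G z := funext fun z => thetaProd_eq ht z
  have h1 : HasDerivAt expTwoPi (2 * Real.pi * Complex.I) 0 := by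
    have := ((hasDerivAt_id (0 : ℂ)).const_mul (2 * Real.pi * Complex.I)).cexp
    simpa using! this
  rw [e]
  refine ((h1.const_sub 1).mul (hGd 0).hasDerivAt).deriv.trans ?_
  simp [hG, expTwoPi_zero]
  ring

lemma qProd_self_ne_zero {t : ℂ} (ht : 0 < t.im) : qProd (expTwoPi t) (expTwoPi t) ≠ 0 := by
  refine qProd_ne_zero (norm_expTwoPi_lt_one ht) fun n h => ?_
  have := congrArg norm h
  rw [← pow_succ', norm_pow, norm_one] at this
  exact (pow_lt_one₀ (norm_nonneg _) (norm_expTwoPi_lt_one ht) n.succ_ne_zero).ne this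

lemma exists_of_thetaProd_eq_zero {t : ℂ} (ht : 0 < t.im) {z : ℂ} (h : thetaProd t z = 0) :
    ∃ m n : ℤ, z = m * t + n := by
  by_contra! hcon
  refine mul_ne_zero (mul_ne_zero (expTwoPi_ne_zero _) ?_) ?_ h
  · refine qProd_ne_zero (norm_expTwoPi_lt_one ht) fun k hk => ?_
    rw [← expTwoPi_natCast_mul, ← expTwoPi_add, expTwoPi_eq_one_iff] at hk
    obtain ⟨n, hn⟩ := hk
    exact hcon (-k) n (by push_cast; linear_combination hn)
  · refine qProd_ne_zero (norm_expTwoPi_lt_one ht) fun k hk => ?_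
    rw [← expTwoPi_natCast_mul, ← expTwoPi_add, expTwoPi_eq_one_iff] at hk
    obtain ⟨n, hn⟩ := hk
    exact hcon (k + 1) (-n) (by push_cast; linear_combination -hn)

lemma expTwoPi_neg_half : expTwoPi (-1 / 2) = -1 := by
  rw [expTwoPi, show 2 * Real.pi * Complex.I * (-1 / 2) = -(Real.pi * Complex.I) by ring,
    Complex.exp_neg, Complex.exp_pi_mul_I]
  norm_num

lemma thetaProd_add_one (t z : ℂ) : thetaProd t (z + 1) = -1 * thetaProd t z := by
  have e1 : expTwoPi (-(z + 1) / 2) = -expTwoPi (-z / 2) := by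
    rw [show -(z + 1) / 2 = -z / 2 + -1 / 2 by ring, expTwoPi_add, expTwoPi_neg_half]; ring
  have e2 : expTwoPi (t - (z + 1)) = expTwoPi (t - z) := by
    rw [show t - (z + 1) = t - z + (-1 : ℤ) by push_cast; ring, expTwoPi_add, expTwoPi_int, mul_one]
  rw [thetaProd, thetaProd, e1, e2, expTwoPi_add, expTwoPi_one, mul_one, neg_one_mul, neg_mul,
    neg_mul]

lemma thetaProd_add_self {t : ℂ} (ht : 0 < t.im) (z : ℂ) :
    thetaProd t (z + t) = -expTwoPi (-t / 2 - z) * thetaProd t z := by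
  rw [thetaProd_eq ht z, thetaProd, qProd_eq_mul (expTwoPi (t - (z + t))) (norm_expTwoPi_lt_one ht),
    ← expTwoPi_add, show t - (z + t) = -z by ring, show -(z + t) / 2 = -z / 2 + -t / 2 by ring,
    show -t / 2 - z = -t / 2 + -z by ring, show -z + t = t - z by ring, add_comm t z,
    expTwoPi_add (-z / 2), expTwoPi_add (-t / 2) (-z), expTwoPi_neg z]
  have := expTwoPi_ne_zero z
  field_simp
  ring

lemma thetaProd_add_one_left (t z : ℂ) : thetaProd (t + 1) z = thetaProd t z := by
  rw [thetaProd, thetaProd, show t + 1 - z = t - z + 1 by ring, expTwoPi_add t, expTwoPi_add (t - z),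
    expTwoPi_one, mul_one, mul_one]

lemma eta_eq_qProd (t : ℂ) :
    ModularForm.eta t = expTwoPi (t / 24) * qProd (expTwoPi t) (expTwoPi t) := by
  rw [ModularForm.eta, qProd]
  congr 1
  · simp only [Function.Periodic.qParam, expTwoPi]; congr 1; push_cast; ring
  · refine tprod_congr fun n => ?_
    rw [ModularForm.eta_q_eq_pow, ← pow_succ']; rfl

lemma im_neg_one_div_pos {t : ℂ} (ht : 0 < t.im) : 0 < (-1 / t).im := by
  have := UpperHalfPlane.im_pnat_div_pos 1 ⟨t, ht⟩
  simpa using this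

lemma csqrt_pow_24 (z : ℂ) : Complex.sqrt z ^ 24 = z ^ 12 := by
  have h : Complex.sqrt z ^ 2 = z := by
    rw [Complex.sqrt, ← Complex.cpow_nat_mul]
    norm_num
  rw [show 24 = 2 * 12 by rfl, pow_mul, h]

/-- Both sides have the same multipliers under `z ↦ z + 1` and `z ↦ z + t`, so they are
proportional. The constant is the ratio of the derivatives at `0`, a ratio of squares of `∏ (1 -
qⁿ)`; its twelfth power is therefore governed by `η ^ 24`. -/
lemma thetaProd_neg_one_div {t : ℂ} (ht : 0 < t.im) :
    ∃ C : ℂ, C ^ 12 * expTwoPi (-1 / t) = expTwoPi t ∧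
      ∀ z, thetaProd (-1 / t) (z / t) = C * expTwoPi (z ^ 2 / (2 * t)) * thetaProd t z := by
  have ht' := im_neg_one_div_pos ht
  have t0 : t ≠ 0 := by rintro rfl; simp at ht
  set s := -1 / t with hs
  set F : ℂ → ℂ := fun z => expTwoPi (-z ^ 2 / (2 * t)) * thetaProd s (z / t) with hF
  have hE : Differentiable ℂ fun z => expTwoPi (-z ^ 2 / (2 * t)) :=
    differentiable_expTwoPi.comp (by fun_prop)
  have hT : Differentiable ℂ fun z => thetaProd s (z / t) :=
    (differentiable_thetaProd ht').comp (by fun_prop)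
  have F1 : ∀ z, F (z + 1) = -1 * F z := fun z => by
    -- In the variable `z / t`, the shift `z ↦ z + 1` is translation by `-s`, and `z ↦ z + t` is
    -- translation by `1`: the two periods trade places.
    have h := thetaProd_add_self ht' (z / t + 1 / t)
    rw [show z / t + 1 / t + s = z / t by rw [hs]; ring,
      show -s / 2 - (z / t + 1 / t) = -(z / t + 1 / (2 * t)) by rw [hs]; field_simp; ring,
      expTwoPi_neg] at h
    have h2 : expTwoPi (-(z + 1) ^ 2 / (2 * t)) =
        expTwoPi (-z ^ 2 / (2 * t)) * (expTwoPi (z / t + 1 / (2 * t)))⁻¹ := by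
      rw [← expTwoPi_neg, ← expTwoPi_add]; congr 1; field_simp; ring
    simp only [hF]
    rw [h, h2, add_div]; ring
  have F2 : ∀ z, F (z + t) = -expTwoPi (-t / 2 - z) * F z := fun z => by
    have h2 : expTwoPi (-(z + t) ^ 2 / (2 * t)) =
        expTwoPi (-t / 2 - z) * expTwoPi (-z ^ 2 / (2 * t)) := by
      rw [← expTwoPi_add]; congr 1; field_simp; ring
    simp only [hF]
    rw [h2, add_div, div_self t0, thetaProd_add_one]; ring
  have hd : deriv (thetaProd t) 0 ≠ 0 := by
    rw [deriv_thetaProd_zero ht]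
    exact mul_ne_zero (neg_ne_zero.2 Complex.two_pi_I_ne_zero) (pow_ne_zero _ (qProd_self_ne_zero ht))
  have key := eq_const_mul_of_same_multipliers ht (hE.mul hT) (differentiable_thetaProd ht)
    (u := fun _ => -1) (v := fun z => -expTwoPi (-t / 2 - z)) (by simp)
    (fun z => neg_ne_zero.2 (expTwoPi_ne_zero _)) F1 (thetaProd_add_one t) F2 (thetaProd_add_self ht)
    (fun z => exists_of_thetaProd_eq_zero ht) (by simp [thetaProd_zero ht']) (thetaProd_zero ht) hd
  have hdF : deriv ((fun z => expTwoPi (-z ^ 2 / (2 * t))) * fun z => thetaProd s (z / t)) 0 =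
      deriv (thetaProd s) 0 / t := by
    have h1 : HasDerivAt (fun z => thetaProd s (z / t)) (deriv (thetaProd s) 0 * (1 / t)) 0 := by
      have h0 : HasDerivAt (thetaProd s) (deriv (thetaProd s) 0) ((0 : ℂ) / t) := by
        rw [zero_div]; exact (differentiable_thetaProd ht' 0).hasDerivAt
      exact h0.comp (0 : ℂ) ((hasDerivAt_id _).div_const t)
    rw [((hE 0).hasDerivAt.mul h1).deriv]
    simp [thetaProd_zero ht', expTwoPi_zero, div_eq_mul_inv]
  rw [hdF, deriv_thetaProd_zero ht, deriv_thetaProd_zero ht'] at key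
  refine ⟨-(2 * Real.pi * Complex.I) * qProd (expTwoPi s) (expTwoPi s) ^ 2 / t /
      (-(2 * Real.pi * Complex.I) * qProd (expTwoPi t) (expTwoPi t) ^ 2), ?_, fun z => ?_⟩
  · have h := ModularForm.eta_comp_eq_csqrt_I_inv ht
    -- The 24th power removes the square roots from the transformation law of `η`.
    have h24 := congrArg (· ^ 24) h
    simp only [Function.comp_apply, Pi.smul_apply, Pi.mul_apply, smul_eq_mul, mul_pow, inv_pow] at h24
    rw [csqrt_pow_24, csqrt_pow_24, eta_eq_qProd, eta_eq_qProd,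
      mul_pow, mul_pow, ← expTwoPi_natCast_mul, ← expTwoPi_natCast_mul, ← hs] at h24
    rw [show ((24 : ℕ) : ℂ) * (s / 24) = s by push_cast; ring,
      show ((24 : ℕ) : ℂ) * (t / 24) = t by push_cast; ring] at h24
    have q0 := qProd_self_ne_zero ht
    have := Complex.two_pi_I_ne_zero
    rw [mul_div_assoc, mul_div_mul_left _ _ (neg_ne_zero.2 this)]
    have hI : Complex.I ^ 12 = 1 := by
      rw [show 12 = 4 * 3 by rfl, pow_mul, Complex.I_pow_four, one_pow]
    rw [hI] at h24
    field_simp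
    linear_combination h24
  · have := key z
    have h3 : expTwoPi (z ^ 2 / (2 * t)) * expTwoPi (-z ^ 2 / (2 * t)) = 1 := by
      rw [← expTwoPi_add, ← expTwoPi_zero]; congr 1; ring
    simp only [Pi.mul_apply] at this
    rw [mul_right_comm, ← this]
    linear_combination -thetaProd s (z / t) * h3

/-! ### Twelfth powers of Siegel functions under `S`, `T` and integral translations of `a`. -/

lemma siegelFunction_eq_qProd (a : ℚ × ℚ) (τ : ℍ) : siegelFunction a τ =
    -expTwoPi ((bernoulliTwo a.1 / 2 : ℚ) * τ) * expTwoPi ((a.2 : ℂ) * (a.1 - 1) / 2) *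
      (qProd (expTwoPi (a.1 * τ + a.2)) (expTwoPi τ) *
        qProd (expTwoPi (τ - (a.1 * τ + a.2))) (expTwoPi τ)) := by
  have hq := norm_expTwoPi_lt_one τ.2
  rw [siegelFunction]
  congr 1
  · congr 1
    · simp only [qPow, expTwoPi]; congr 2; ring
    · simp only [expTwoPi]; congr 1; ring
  · rw [qProd, qProd, ← (multipliable_qProd _ hq).tprod_mul (multipliable_qProd _ hq)]
    refine tprod_congr fun n => ?_
    rw [siegelFactor]
    simp only [← expTwoPi_natCast_mul, ← expTwoPi_add]
    simp only [qPow, expTwoPi, ← Complex.exp_add]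
    have e1 : 2 * Real.pi * Complex.I * (n + a.1 : ℚ) * τ + 2 * Real.pi * Complex.I * a.2 =
        2 * Real.pi * Complex.I * (a.1 * τ + a.2 + n * τ) := by push_cast; ring
    have e2 : 2 * Real.pi * Complex.I * (n + 1 - a.1 : ℚ) * τ + -(2 * Real.pi * Complex.I * a.2) =
        2 * Real.pi * Complex.I * (τ - (a.1 * τ + a.2) + n * τ) := by push_cast; ring
    rw [e1, e2]

/-- With `z = a₁τ + a₂`, twelve times the exponent `B₂(a₁)τ/2 + a₂(a₁ - 1)/2 + z/2` is `τ + 6a₁z`.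
The twelfth power also absorbs the signs in the theta multipliers. -/
lemma siegelFunction_pow_twelve (a : ℚ × ℚ) (τ : ℍ) : siegelFunction a τ ^ 12 =
    expTwoPi (τ + 6 * a.1 * (a.1 * τ + a.2)) * thetaProd τ (a.1 * τ + a.2) ^ 12 := by
  have e : siegelFunction a τ = -expTwoPi ((bernoulliTwo a.1 / 2 : ℚ) * τ
      + (a.2 : ℂ) * (a.1 - 1) / 2 + (a.1 * τ + a.2) / 2) * thetaProd τ (a.1 * τ + a.2) := by
    have : expTwoPi ((a.1 * τ + a.2) / 2) * expTwoPi (-(a.1 * τ + a.2) / 2) = 1 := by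
      rw [← expTwoPi_add, ← expTwoPi_zero]; congr 1; ring
    rw [siegelFunction_eq_qProd, thetaProd,
      expTwoPi_add (_ + _), expTwoPi_add ((bernoulliTwo a.1 / 2 : ℚ) * (τ : ℂ))]
    generalize qProd _ _ = A at *
    generalize expTwoPi ((a.1 * τ + a.2) / 2) = u at *
    generalize expTwoPi (-(a.1 * τ + a.2) / 2) = v at *
    linear_combination (-expTwoPi ((bernoulliTwo a.1 / 2 : ℚ) * τ)
      * expTwoPi ((a.2 : ℂ) * (a.1 - 1) / 2) * A *
        qProd (expTwoPi (τ - (a.1 * τ + a.2))) (expTwoPi τ)) * (-this)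
  rw [e, mul_pow, Even.neg_pow (by decide), ← expTwoPi_natCast_mul]
  congr 2
  simp only [bernoulliTwo]; push_cast; ring

lemma siegelFunction_pow_twelve_S (a : ℚ × ℚ) (τ : ℍ) :
    siegelFunction a (ModularGroup.S • τ) ^ 12 = siegelFunction (a.2, -a.1) τ ^ 12 := by
  obtain ⟨C, hC, h⟩ := thetaProd_neg_one_div τ.2
  have hS : ((ModularGroup.S • τ : ℍ) : ℂ) = -1 / τ := by
    rw [modular_S_smul]; simp [neg_div]
  have t0 := τ.ne_zero
  rw [siegelFunction_pow_twelve, siegelFunction_pow_twelve, hS,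
    show (a.1 : ℂ) * (-1 / τ) + a.2 = (a.2 * τ - a.1) / τ by field_simp; ring]
  have := h (a.2 * τ - a.1)
  push_cast
  rw [this, mul_pow, mul_pow, ← expTwoPi_natCast_mul, expTwoPi_add,
    show (a.2 : ℂ) * τ + -a.1 = a.2 * τ - a.1 by ring, expTwoPi_add τ, ← hC]
  have e : expTwoPi (6 * a.1 * ((a.2 * τ - a.1) / τ)) *
      expTwoPi ((12 : ℕ) * ((a.2 * τ - a.1) ^ 2 / (2 * τ))) =
      expTwoPi (6 * a.2 * (a.2 * τ - a.1)) := by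
    rw [← expTwoPi_add]; congr 1; push_cast; field_simp; ring
  rw [← e]; ring

lemma siegelFunction_pow_twelve_T (a : ℚ × ℚ) (τ : ℍ) :
    siegelFunction a (ModularGroup.T • τ) ^ 12 = siegelFunction (a.1, a.1 + a.2) τ ^ 12 := by
  have hT : ((ModularGroup.T • τ : ℍ) : ℂ) = τ + 1 := by
    rw [modular_T_smul, coe_vadd]; push_cast; ring
  rw [siegelFunction_pow_twelve, siegelFunction_pow_twelve, hT, thetaProd_add_one_left]
  push_cast
  rw [show (a.1 : ℂ) * (τ + 1) + a.2 = a.1 * τ + (a.1 + a.2) by ring,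
    show (τ : ℂ) + 1 + 6 * a.1 * (a.1 * τ + (a.1 + a.2)) =
      τ + 6 * a.1 * (a.1 * τ + (a.1 + a.2)) + 1 by ring, expTwoPi_add _ 1, expTwoPi_one, mul_one]

lemma siegelFunction_pow_twelve_add_snd (a : ℚ × ℚ) (τ : ℍ) :
    siegelFunction (a.1, a.2 + 1) τ ^ 12 = expTwoPi (6 * a.1) * siegelFunction a τ ^ 12 := by
  rw [siegelFunction_pow_twelve, siegelFunction_pow_twelve, ← mul_assoc, ← expTwoPi_add]
  push_cast
  rw [← add_assoc, thetaProd_add_one, mul_pow]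
  norm_num
  left
  congr 1; ring

lemma siegelFunction_pow_twelve_add_fst (a : ℚ × ℚ) (τ : ℍ) :
    siegelFunction (a.1 + 1, a.2) τ ^ 12 = expTwoPi (-(6 * a.2)) * siegelFunction a τ ^ 12 := by
  rw [siegelFunction_pow_twelve, siegelFunction_pow_twelve, ← mul_assoc, ← expTwoPi_add]
  push_cast
  rw [show ((a.1 : ℂ) + 1) * τ + a.2 = a.1 * τ + a.2 + τ by ring, thetaProd_add_self τ.2, mul_pow,
    Even.neg_pow (by decide), ← expTwoPi_natCast_mul, ← mul_assoc, ← expTwoPi_add]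
  congr 2
  push_cast; ring

/-! ### Expansions at `i∞` in powers of `q^{1/M}`. -/

open Filter Asymptotics Polynomial Topology

open scoped MatrixGroups Manifold ModularForm

/-- The `M`-th root `e^{2πiτ/M}` of `q`. -/
noncomputable def qRoot (M : ℕ) (τ : ℍ) : ℂ := expTwoPi (τ / M)

lemma qRoot_ne_zero (M : ℕ) (τ : ℍ) : qRoot M τ ≠ 0 := expTwoPi_ne_zero _

lemma qRoot_pow_self {M : ℕ} (hM : M ≠ 0) (τ : ℍ) : qRoot M τ ^ M = expTwoPi τ := by
  rw [qRoot, ← expTwoPi_natCast_mul, mul_div_cancel₀ _ (by exact_mod_cast hM)]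

lemma norm_qRoot_lt_one {M : ℕ} (hM : M ≠ 0) (τ : ℍ) : ‖qRoot M τ‖ < 1 := by
  refine norm_expTwoPi_lt_one ?_
  have : 0 < (M : ℝ) := by exact_mod_cast Nat.pos_of_ne_zero hM
  rw [Complex.div_natCast_im]
  exact div_pos τ.2 this

lemma tendsto_qRoot {M : ℕ} (hM : M ≠ 0) : Tendsto (qRoot M) atImInfty (𝓝 0) := by
  have h := UpperHalfPlane.qParam_tendsto_atImInfty (h := M)
    (by exact_mod_cast Nat.pos_of_ne_zero hM)
  refine h.congr fun τ => ?_
  simp only [Function.Periodic.qParam, qRoot, expTwoPi]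
  congr 1; push_cast; ring

lemma qRoot_pow_isBigO {M : ℕ} (hM : M ≠ 0) {m n : ℕ} (h : n ≤ m) (l : Filter ℍ) :
    (fun τ => qRoot M τ ^ m) =O[l] fun τ => qRoot M τ ^ n := by
  refine IsBigO.of_bound 1 (Eventually.of_forall fun τ => ?_)
  rw [one_mul, norm_pow, norm_pow]
  exact pow_le_pow_of_le_one (norm_nonneg _) (norm_qRoot_lt_one hM τ).le h

section expansion

variable {A : Subring ℂ} {M k l : ℕ} {f g : ℍ → ℂ}

lemma tendsto_eval₂_qRoot (hM : M ≠ 0) (p : A[X]) :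
    Tendsto (fun τ => p.eval₂ A.subtype (qRoot M τ)) atImInfty (𝓝 (p.coeff 0)) := by
  have h : Continuous fun x : ℂ => p.eval₂ A.subtype x := p.continuous_eval₂ _
  have h2 := (h.tendsto 0).comp (tendsto_qRoot hM)
  simpa [eval₂_at_zero] using! h2

/-- `f` has at `i∞` an asymptotic expansion in powers of `q^{1/M}` with coefficients in `A` and
pole order at most `k`. -/
def HasExpansion (A : Subring ℂ) (M k : ℕ) (f : ℍ → ℂ) : Prop :=
  ∀ n : ℕ, ∃ p : A[X], (fun τ => qRoot M τ ^ k * f τ - p.eval₂ A.subtype (qRoot M τ))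
    =O[atImInfty] fun τ => qRoot M τ ^ n

namespace HasExpansion

lemma of_eq (p : A[X]) (h : ∀ τ, qRoot M τ ^ k * f τ = p.eval₂ A.subtype (qRoot M τ)) :
    HasExpansion A M k f := fun n => ⟨p, by simp [h, isBigO_zero]⟩

lemma const {c : ℂ} (hc : c ∈ A) : HasExpansion A M 0 fun _ => c :=
  of_eq (C ⟨c, hc⟩) fun τ => by simp

lemma mono (hM : M ≠ 0) (hf : HasExpansion A M k f) (h : k ≤ l) : HasExpansion A M l f := by
  intro n
  obtain ⟨p, hp⟩ := hf n
  refine ⟨X ^ (l - k) * p, ?_⟩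
  have h2 := (qRoot_pow_isBigO hM (Nat.zero_le (l - k)) atImInfty).mul hp
  refine h2.congr (fun τ => ?_) fun τ => by simp
  rw [eval₂_mul, eval₂_X_pow, mul_sub, ← mul_assoc, ← pow_add, Nat.sub_add_cancel h]

lemma add_same (hf : HasExpansion A M k f) (hg : HasExpansion A M k g) :
    HasExpansion A M k (f + g) := by
  intro n
  obtain ⟨p, hp⟩ := hf n
  obtain ⟨r, hr⟩ := hg n
  refine ⟨p + r, (hp.add hr).congr_left fun τ => ?_⟩
  rw [eval₂_add, Pi.add_apply]; ring

lemma add (hM : M ≠ 0) (hf : HasExpansion A M k f) (hg : HasExpansion A M l g) :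
    HasExpansion A M (max k l) (f + g) :=
  (hf.mono hM (le_max_left _ _)).add_same (hg.mono hM (le_max_right _ _))

lemma exists_tendsto (hM : M ≠ 0) (hf : HasExpansion A M k f) :
    ∃ c ∈ A, Tendsto (fun τ => qRoot M τ ^ k * f τ) atImInfty (𝓝 c) := by
  obtain ⟨p, hp⟩ := hf 1
  have h0 := hp.trans_tendsto (by simpa using tendsto_qRoot hM)
  refine ⟨p.coeff 0, (p.coeff 0).2, ?_⟩
  simpa using h0.add (tendsto_eval₂_qRoot hM p)

lemma isBigO_one (hM : M ≠ 0) (hf : HasExpansion A M k f) :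
    (fun τ => qRoot M τ ^ k * f τ) =O[atImInfty] fun _ => (1 : ℂ) := by
  obtain ⟨c, -, hc⟩ := hf.exists_tendsto hM
  exact hc.isBigO_one ℂ

lemma mul (hM : M ≠ 0) (hf : HasExpansion A M k f) (hg : HasExpansion A M l g) :
    HasExpansion A M (k + l) (f * g) := by
  intro n
  obtain ⟨p, hp⟩ := hf n
  obtain ⟨r, hr⟩ := hg n
  refine ⟨p * r, ?_⟩
  have h1 := (hf.isBigO_one hM).mul hr
  have h2 := hp.mul ((tendsto_eval₂_qRoot hM r).isBigO_one ℂ)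
  simp only [one_mul, mul_one] at h1 h2
  refine (h1.add h2).congr_left fun τ => ?_
  rw [eval₂_mul, Pi.mul_apply]; ring

lemma neg (hf : HasExpansion A M k f) : HasExpansion A M k (-f) := by
  intro n
  obtain ⟨p, hp⟩ := hf n
  refine ⟨-p, hp.neg_left.congr_left fun τ => ?_⟩
  rw [eval₂_neg, Pi.neg_apply]; ring

lemma pow (hM : M ≠ 0) (hf : HasExpansion A M k f) (n : ℕ) :
    HasExpansion A M (n * k) (f ^ n) := by
  induction n with
  | zero => simpa using! (const A.one_mem : HasExpansion A M 0 _)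
  | succ n ih => rw [pow_succ, add_mul, one_mul]; exact ih.mul hM hf

/-- A vanishing limit forces the constant term of the approximating polynomial to vanish, so it can
be divided by `X`. The division costs one order of precision, hence the use of `n + 1`. -/
lemma of_succ (hM : M ≠ 0) (hf : HasExpansion A M (k + 1) f)
    (h0 : Tendsto (fun τ => qRoot M τ ^ (k + 1) * f τ) atImInfty (𝓝 0)) :
    HasExpansion A M k f := by
  intro n
  obtain ⟨p, hp⟩ := hf (n + 1)
  have hp0 : Tendsto (fun τ => qRoot M τ ^ (k + 1) * f τ - p.eval₂ A.subtype (qRoot M τ))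
      atImInfty (𝓝 0) :=
    hp.trans_tendsto (by simpa using (tendsto_qRoot hM).pow (n + 1))
  have hc : (p.coeff 0 : ℂ) = 0 := by
    have := h0.sub hp0
    simp only [sub_sub_cancel, sub_zero] at this
    exact tendsto_nhds_unique (tendsto_eval₂_qRoot hM p) this
  have hX : X * p.divX = p := by
    have := p.X_mul_divX_add
    rwa [show p.coeff 0 = 0 by exact_mod_cast hc, C_0, add_zero] at this
  refine ⟨p.divX, ?_⟩
  have h2 := (isBigO_refl (fun τ => (qRoot M τ)⁻¹) atImInfty).mul hp
  refine h2.congr (fun τ => ?_) fun τ => ?_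
  · have := qRoot_ne_zero M τ
    conv_lhs => rw [← hX]
    rw [eval₂_mul, eval₂_X, mul_sub, pow_succ', ← mul_assoc, ← mul_assoc, ← mul_assoc,
      inv_mul_cancel₀ this, one_mul, one_mul]
  · rw [pow_succ', inv_mul_cancel_left₀ (qRoot_ne_zero M τ)]

/-- The constant term is a unit of `A`, so a truncated geometric series inverts the approximating
polynomial modulo `X ^ n`. -/
lemma inv (hM : M ≠ 0) (hf : HasExpansion A M 0 f) {c : ℂ} (hc0 : c ≠ 0) (hc : c⁻¹ ∈ A)
    (h : Tendsto f atImInfty (𝓝 c)) : HasExpansion A M 0 f⁻¹ := by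
  intro n
  -- Precision at least `1` is needed, even for `n = 0`, to identify the constant term of `p` with
  -- `c`.
  obtain ⟨p, hp⟩ := hf (n + 1)
  simp only [pow_zero, one_mul] at hp ⊢
  have hp0 : Tendsto (fun τ => f τ - p.eval₂ A.subtype (qRoot M τ)) atImInfty (𝓝 0) :=
    hp.trans_tendsto (by simpa using (tendsto_qRoot hM).pow (n + 1))
  have hpc : (p.coeff 0 : ℂ) = c := by
    have := h.sub hp0
    simp only [sub_sub_cancel, sub_zero] at this
    exact tendsto_nhds_unique (tendsto_eval₂_qRoot hM p) this
  set d : A := ⟨c⁻¹, hc⟩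
  have hd : C d * C (p.coeff 0) = (1 : A[X]) := by
    rw [← C_mul, ← C_1]
    congr 1
    apply Subtype.ext
    simp [d, hpc, hc0]
  set u : A[X] := -(C d * p.divX) with hu
  have hpu : C d * p = 1 - X * u := by
    conv_lhs => rw [← p.X_mul_divX_add]
    rw [mul_add, hd, hu]; ring
  set r : A[X] := C d * ∑ i ∈ Finset.range n, (X * u) ^ i with hr
  have hpr : p * r = 1 - X ^ n * u ^ n := by
    rw [hr, mul_left_comm, ← mul_assoc, hpu, mul_neg_geom_sum, mul_pow]
  refine ⟨r, ?_⟩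
  have hinv : (fun τ => (f τ)⁻¹) =O[atImInfty] fun _ => (1 : ℂ) := (h.inv₀ hc0).isBigO_one ℂ
  have h1 : (fun τ => qRoot M τ ^ n * (u ^ n).eval₂ A.subtype (qRoot M τ)) =O[atImInfty]
      fun τ => qRoot M τ ^ n := by
    simpa using (isBigO_refl (fun τ => qRoot M τ ^ n) atImInfty).mul
      ((tendsto_eval₂_qRoot hM (u ^ n)).isBigO_one ℂ)
  have h2 : (fun τ => (f τ - p.eval₂ A.subtype (qRoot M τ)) * r.eval₂ A.subtype (qRoot M τ))
      =O[atImInfty] fun τ => qRoot M τ ^ n := by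
    simpa using (hp.trans (qRoot_pow_isBigO hM n.le_succ _)).mul
      ((tendsto_eval₂_qRoot hM r).isBigO_one ℂ)
  have h3 := hinv.mul (h1.sub h2)
  simp only [one_mul] at h3
  refine h3.congr' ?_ EventuallyEq.rfl
  filter_upwards [h.eventually_ne hc0] with τ hτ
  have e : p.eval₂ A.subtype (qRoot M τ) * r.eval₂ A.subtype (qRoot M τ) =
      1 - qRoot M τ ^ n * (u ^ n).eval₂ A.subtype (qRoot M τ) := by
    rw [← eval₂_mul, hpr, eval₂_sub, eval₂_one, eval₂_mul, eval₂_X_pow]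
  rw [Pi.inv_apply]
  field_simp
  linear_combination e

end HasExpansion

lemma qProd_sub_one_isBigO {x : ℍ → ℂ} (hM : M ≠ 0) (hx : Tendsto x atImInfty (𝓝 0)) :
    (fun τ => qProd (x τ) (qRoot M τ ^ M) - 1) =O[atImInfty] x := by
  have hq : Tendsto (fun τ => qRoot M τ ^ M) atImInfty (𝓝 0) := by
    simpa [hM] using (tendsto_qRoot hM).pow M
  have h1 : Tendsto (fun τ => (1 - ‖qRoot M τ ^ M‖)⁻¹) atImInfty (𝓝 1) := by
    have h0 : Tendsto (fun τ => 1 - ‖qRoot M τ ^ M‖) atImInfty (𝓝 1) := by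
      have := hq.norm.const_sub 1
      rwa [norm_zero, sub_zero] at this
    simpa only [inv_one] using h0.inv₀ one_ne_zero
  set y : ℍ → ℝ := fun τ => ‖x τ‖ * (1 - ‖qRoot M τ ^ M‖)⁻¹ with hy
  have hy0 : Tendsto y atImInfty (𝓝 0) := by simpa [hy] using hx.norm.mul h1
  have hyx : y =O[atImInfty] x := by
    simpa [hy] using (isBigO_refl x atImInfty).norm_left.mul (h1.isBigO_one ℂ)
  have he := ((Real.hasDerivAt_exp 0).isBigO_sub.comp_tendsto hy0)
  simp only [Function.comp_def, sub_zero, Real.exp_zero] at he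
  refine (IsBigO.of_bound 1 (Eventually.of_forall fun τ => ?_)).trans (he.trans hyx)
  rw [one_mul]
  refine (norm_qProd_sub_one_le _ ?_).trans (le_abs_self _)
  rw [norm_pow]
  exact pow_lt_one₀ (norm_nonneg _) (norm_qRoot_lt_one hM τ) hM

lemma tendsto_qProd_one {x : ℍ → ℂ} (hM : M ≠ 0) (hx : Tendsto x atImInfty (𝓝 0)) :
    Tendsto (fun τ => qProd (x τ) (qRoot M τ ^ M)) atImInfty (𝓝 1) := by
  simpa using ((qProd_sub_one_isBigO hM hx).trans_tendsto hx).add_const 1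

lemma hasExpansion_qProd (hM : M ≠ 0) {c : ℂ} (hc : c ∈ A) (i : ℕ) :
    HasExpansion A M 0 fun τ => qProd (c * qRoot M τ ^ i) (qRoot M τ ^ M) := by
  intro n
  set p : A[X] := ∏ j ∈ Finset.range n, (1 - C ⟨c, hc⟩ * X ^ i * (X ^ M) ^ j)
  refine ⟨p, ?_⟩
  have hx : (fun τ => c * qRoot M τ ^ i * (qRoot M τ ^ M) ^ n) =O[atImInfty]
      fun τ => qRoot M τ ^ n := by
    have : (fun τ => c * qRoot M τ ^ (i + M * n)) =O[atImInfty] fun τ => qRoot M τ ^ n :=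
      (qRoot_pow_isBigO hM ((Nat.le_mul_of_pos_left n (Nat.pos_of_ne_zero hM)).trans
        (Nat.le_add_left _ _)) _).const_mul_left c
    exact this.congr_left fun τ => by rw [pow_add, pow_mul, mul_assoc]
  -- For `n = 0` and `i = 0` the argument of the product does not tend to `0`; one factor is split
  -- off first. For `n > 0` the first `n` factors form `p`, and the remaining product is `1 +
  -- O(q^{n/M})`.
  rcases Nat.eq_zero_or_pos n with rfl | hn
  · have h0 : (fun τ => qProd (c * qRoot M τ ^ i * qRoot M τ ^ M) (qRoot M τ ^ M)) =O[atImInfty]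
        fun _ => (1 : ℂ) := by
      refine (tendsto_qProd_one hM ?_).isBigO_one ℂ
      simpa [hM] using (((tendsto_qRoot hM).pow i).const_mul c).mul ((tendsto_qRoot hM).pow M)
    have h1 : (fun τ => 1 - c * qRoot M τ ^ i) =O[atImInfty] fun _ => (1 : ℂ) :=
      (tendsto_const_nhds.sub (((tendsto_qRoot hM).pow i).const_mul c)).isBigO_one ℂ
    have h2 := h1.mul h0
    simp only [mul_one] at h2
    have h3 := h2.sub ((tendsto_eval₂_qRoot hM p).isBigO_one ℂ)
    refine h3.congr (fun τ => ?_) fun τ => by simp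
    beta_reduce
    rw [pow_zero, one_mul, qProd_eq_mul (c * qRoot M τ ^ i) (by
      rw [norm_pow]; exact pow_lt_one₀ (norm_nonneg _) (norm_qRoot_lt_one hM τ) hM)]
  have hx0 := hx.trans_tendsto (by simpa [hn.ne'] using (tendsto_qRoot hM).pow n)
  have h := ((tendsto_eval₂_qRoot hM p).isBigO_one ℂ).mul
    ((qProd_sub_one_isBigO hM hx0).trans hx)
  simp only [one_mul] at h
  refine h.congr_left fun τ => ?_
  beta_reduce
  rw [pow_zero, one_mul, qProd_eq_prod_mul (c * qRoot M τ ^ i) (by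
      rw [norm_pow]; exact pow_lt_one₀ (norm_nonneg _) (norm_qRoot_lt_one hM τ) hM) n]
  have : p.eval₂ A.subtype (qRoot M τ) =
      ∏ j ∈ Finset.range n, (1 - c * qRoot M τ ^ i * (qRoot M τ ^ M) ^ j) := by
    rw [eval₂_finsetProd]
    refine Finset.prod_congr rfl fun j _ => ?_
    simp [eval₂_mul, eval₂_pow]
  rw [this]; ring

/-! ### Expansions of `E₄`, `Δ` and `j`. -/

lemma hasExpansion_E₄ (hM : M ≠ 0) : HasExpansion A M 0 ModularForm.E₄ := by
  intro n
  have hcoeff : ∀ m, ∃ d : ℤ, (qExpansion 1 ModularForm.E₄).coeff m = (d : ℂ) := fun m => by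
    rw [EisensteinSeries.E_qExpansion_coeff _ ⟨2, rfl⟩]
    split_ifs
    · exact ⟨1, by simp⟩
    · refine ⟨240 * ArithmeticFunction.sigma 3 m, ?_⟩
      norm_num [show _root_.bernoulli 4 = -1 / 30 by decide +kernel]
  choose d hd using hcoeff
  have h1 := ModularForm.hasSum_qExpansion ModularForm.E₄ one_pos one_mem_strictPeriods_SL
  have h2 := UpperHalfPlane.hasFPowerSeries_cuspFunction ModularForm.E₄ one_pos
    (ModularFormClass.analyticAt_cuspFunction_zero ModularForm.E₄ one_pos one_mem_strictPeriods_SL)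
    h1
  have h3 := h2.hasFPowerSeriesAt.isBigO_sub_partialSum_pow n
  have hq : Tendsto (fun τ => qRoot M τ ^ M) atImInfty (𝓝 0) := by
    simpa [hM] using (tendsto_qRoot hM).pow M
  have h4 := h3.comp_tendsto hq
  refine ⟨∑ m ∈ Finset.range n, C (d m : A) * (X ^ M) ^ m, ?_⟩
  have h5 : (fun τ => ‖qRoot M τ ^ M‖ ^ n) =O[atImInfty] fun τ => qRoot M τ ^ n := by
    have := (qRoot_pow_isBigO hM (Nat.le_mul_of_pos_left n (Nat.pos_of_ne_zero hM)) atImInfty)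
    refine this.norm_left.congr_left fun τ => ?_
    rw [norm_pow, norm_pow, pow_mul]
  refine (h4.trans h5).congr_left fun τ => ?_
  have e : Function.Periodic.qParam 1 (τ : ℂ) = qRoot M τ ^ M := by
    rw [qRoot_pow_self hM, Function.Periodic.qParam, expTwoPi]; simp
  have hE := SlashInvariantFormClass.eq_cuspFunction ModularForm.E₄ τ one_mem_strictPeriods_SL
    one_ne_zero
  rw [e] at hE
  simp only [Function.comp_apply, zero_add, hE, pow_zero, one_mul]
  congr 1
  rw [FormalMultilinearSeries.partialSum, eval₂_finsetSum]
  refine Finset.sum_congr rfl fun m _ => ?_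
  rw [qExpansionFormalMultilinearSeries, FormalMultilinearSeries.ofScalars_apply_eq, hd]
  rw [eval₂_mul, eval₂_pow, eval₂_X_pow, eval₂_C, map_intCast, smul_eq_mul]

lemma discriminant_eq_qProd (hM : M ≠ 0) (τ : ℍ) : ModularForm.discriminant τ =
    qRoot M τ ^ M * qProd (1 * qRoot M τ ^ M) (qRoot M τ ^ M) ^ 24 := by
  rw [ModularForm.discriminant, eta_eq_qProd, mul_pow, ← expTwoPi_natCast_mul, one_mul,
    qRoot_pow_self hM]
  congr 2; push_cast; ring

lemma hasExpansion_modularJ (hM : M ≠ 0) : HasExpansion A M M modularJ := by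
  have hx : Tendsto (fun τ => 1 * qRoot M τ ^ M) atImInfty (𝓝 0) := by
    simpa [hM] using (tendsto_qRoot hM).pow M
  have h1 := ((hasExpansion_qProd hM A.one_mem M).inv hM one_ne_zero (by simp [A.one_mem])
    (tendsto_qProd_one hM hx)).pow hM 24
  have h2 := ((hasExpansion_E₄ (A := A) hM).pow hM 3).mul hM h1
  have h3 : HasExpansion A M M fun τ => (qRoot M τ ^ M)⁻¹ :=
    .of_eq 1 fun τ => by simp [qRoot_ne_zero]
  have h4 := h3.mul hM h2
  simp only [mul_zero, add_zero] at h4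
  convert h4 using 1
  ext τ
  have := qRoot_ne_zero M τ
  simp only [modularJ, discriminant_eq_qProd hM, Pi.mul_apply, Pi.pow_apply, Pi.inv_apply]
  rw [inv_pow, div_eq_mul_inv, mul_inv]; ring

lemma tendsto_modularJ (hM : M ≠ 0) :
    Tendsto (fun τ => qRoot M τ ^ M * modularJ τ) atImInfty (𝓝 1) := by
  have hx : Tendsto (fun τ => 1 * qRoot M τ ^ M) atImInfty (𝓝 0) := by
    simpa [hM] using (tendsto_qRoot hM).pow M
  have h1 := ((tendsto_qProd_one hM hx).pow 24).inv₀ (by simp)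
  have h2 : Tendsto (ModularForm.E₄ : ℍ → ℂ) atImInfty (𝓝 1) := by
    have hc := (ModularFormClass.analyticAt_cuspFunction_zero ModularForm.E₄ one_pos
      one_mem_strictPeriods_SL).continuousAt
    have h0 := EisensteinSeries.E_qExpansion_coeff_zero (k := 4) (by norm_num) ⟨2, rfl⟩
    rw [qExpansion_coeff] at h0
    simp only [Nat.factorial_zero, Nat.cast_one, inv_one, one_mul, iteratedDeriv_zero] at h0
    have := hc.tendsto.comp (UpperHalfPlane.qParam_tendsto_atImInfty one_pos)
    rw [h0] at this
    exact this.congr fun τ => SlashInvariantFormClass.eq_cuspFunction ModularForm.E₄ τ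
      one_mem_strictPeriods_SL one_ne_zero
  have h3 := (h2.pow 3).mul h1
  simp only [one_pow, inv_one, mul_one] at h3
  refine h3.congr fun τ => ?_
  have := qRoot_ne_zero M τ
  rw [modularJ, discriminant_eq_qProd hM, one_mul]
  field_simp

/-! ### Invariant functions as polynomials in `j`, and integrality of permuted families. -/

lemma modularJ_smul (γ : SL(2, ℤ)) (τ : ℍ) : modularJ (γ • τ) = modularJ τ := by
  have hγ : (γ : GL (Fin 2) ℝ) ∈ 𝒮ℒ := ⟨γ, rfl⟩
  have h1 := SlashInvariantForm.slash_action_eqn'' ModularForm.E₄ hγ τ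
  have h2 := SlashInvariantForm.slash_action_eqn'' CuspForm.discriminant hγ τ
  simp only [CuspForm.coe_discriminant] at h2
  have h3 := ModularForm.discriminant_ne_zero τ
  have h4 := denom_ne_zero (γ : GL (Fin 2) ℝ) τ
  change ModularForm.E₄ ((γ : GL (Fin 2) ℝ) • τ) ^ 3 /
    ModularForm.discriminant ((γ : GL (Fin 2) ℝ) • τ) = _
  rw [h1, h2, modularJ, mul_pow, ← zpow_natCast (denom _ _ ^ (4 : ℤ)), ← zpow_mul]
  exact mul_div_mul_left _ _ (zpow_ne_zero _ h4)

lemma mdifferentiable_modularJ : MDiff modularJ := by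
  have h : MDiff (ModularForm.discriminant : ℍ → ℂ) := CuspForm.discriminant.holo'
  have h4 : MDiff (ModularForm.E₄ : ℍ → ℂ) := ModularForm.E₄.holo'
  exact (h4.pow 3).div h ModularForm.discriminant_ne_zero

/-- Such a function is a modular form of level one and weight zero; invariance carries boundedness
at `i∞` to all cusps. -/
lemma eq_const_of_invariant_of_bounded (hf : MDiff f)
    (hS : ∀ τ, f (ModularGroup.S • τ) = f τ) (hT : ∀ τ, f (ModularGroup.T • τ) = f τ)
    (hb : f =O[atImInfty] fun _ => (1 : ℂ)) : ∃ c, f = Function.const _ c := by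
  have hS' : f ∣[(0 : ℤ)] ModularGroup.S = f := by
    ext τ; rw [ModularForm.SL_slash_apply, hS]; simp
  have hT' : f ∣[(0 : ℤ)] ModularGroup.T = f := by
    ext τ; rw [ModularForm.SL_slash_apply, hT]; simp
  have hinv := SlashInvariantForm.slash_action_generators_SL2Z hS' hT'
  let F : ModularForm 𝒮ℒ 0 :=
    { toFun := f
      slash_action_eq' := by
        rintro _ ⟨γ, rfl⟩
        exact hinv γ
      holo' := hf
      bdd_at_cusps' := fun {c} hc => by
        rw [Subgroup.IsArithmetic.isCusp_iff_isCusp_SL2Z] at hc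
        rw [OnePoint.isBoundedAt_iff_forall_SL2Z hc]
        intro γ _
        rw [hinv γ, IsBoundedAtImInfty, BoundedAtFilter]
        exact hb.trans (isBigO_of_le _ fun τ => by simp) }
  exact ModularFormClass.levelOne_weight_zero_const F

lemma qRoot_T (M : ℕ) (τ : ℍ) :
    qRoot M (ModularGroup.T • τ) = expTwoPi (1 / M) * qRoot M τ := by
  have hT : ((ModularGroup.T • τ : ℍ) : ℂ) = τ + 1 := by
    rw [modular_T_smul, coe_vadd]; push_cast; ring
  rw [qRoot, qRoot, hT, ← expTwoPi_add]; congr 1; ring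

/-- A holomorphic function on the upper half-plane that is invariant under `SL₂(ℤ)`, with an
expansion at `i∞` with coefficients in `A`, is a polynomial in `j` with coefficients in `A`. -/
theorem mem_of_invariant (hM : M ≠ 0) {R : Subring (ℍ → ℂ)} (hR : modularJ ∈ R)
    (hA : ∀ c ∈ A, (fun _ => c) ∈ R) (k : ℕ) : ∀ f : ℍ → ℂ, MDiff f →
    (∀ τ, f (ModularGroup.S • τ) = f τ) → (∀ τ, f (ModularGroup.T • τ) = f τ) →
    HasExpansion A M k f → f ∈ R := by
  induction k with
  | zero =>
    intro f hf hS hT he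
    obtain ⟨c, rfl⟩ := eq_const_of_invariant_of_bounded hf hS hT (by simpa using he.isBigO_one hM)
    obtain ⟨d, hd, h⟩ := he.exists_tendsto hM
    simp only [pow_zero, one_mul, Function.const_apply] at h
    have := tendsto_nhds_unique tendsto_const_nhds h
    subst this
    exact hA _ hd
  | succ k ih =>
    intro f hf hS hT he
    obtain ⟨c, hc, h⟩ := he.exists_tendsto hM
    -- If `k + 1 = M * l`, the leading term is cancelled by `c * j ^ l`. Otherwise `T` multiplies it
    -- by `e^{2πi(k+1)/M} ≠ 1`, so invariance gives `c = 0`. Either way the pole order drops.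
    by_cases hdvd : M ∣ k + 1
    · obtain ⟨l, hl⟩ := hdvd
      set g : ℍ → ℂ := f + -((fun _ => c) * modularJ ^ l) with hg
      have hjl : HasExpansion A M (k + 1) ((fun _ => c) * modularJ ^ l) := by
        have := (HasExpansion.const (M := M) hc).mul hM
          ((hasExpansion_modularJ (A := A) hM).pow hM l)
        rwa [zero_add, mul_comm, ← hl] at this
      have hmem : g ∈ R := by
        refine ih g (hf.add ((mdifferentiable_const.mul (mdifferentiable_modularJ.pow l)).neg))
          (fun τ => by
            simp only [hg, Pi.add_apply, Pi.neg_apply, Pi.mul_apply, Pi.pow_apply, hS,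
              modularJ_smul])
          (fun τ => by
            simp only [hg, Pi.add_apply, Pi.neg_apply, Pi.mul_apply, Pi.pow_apply, hT,
              modularJ_smul])
          ((he.add_same hjl.neg).of_succ hM ?_)
        have h2 := h.sub (((tendsto_modularJ hM).pow l).const_mul c)
        simp only [one_pow, mul_one, sub_self] at h2
        refine h2.congr fun τ => ?_
        simp only [hg, Pi.add_apply, Pi.neg_apply, Pi.mul_apply, Pi.pow_apply]
        rw [mul_pow, ← pow_mul, ← hl]; ring
      have : f = g + (fun _ => c) * modularJ ^ l := by rw [hg]; ring
      rw [this]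
      exact R.add_mem hmem (R.mul_mem (hA c hc) (R.pow_mem hR l))
    · refine ih f hf hS hT (he.of_succ hM ?_)
      suffices c = 0 by rwa [this] at h
      have hTt : Tendsto (fun τ : ℍ => ModularGroup.T • τ) atImInfty atImInfty := by
        rw [atImInfty, tendsto_comap_iff]
        refine tendsto_comap.congr fun τ => ?_
        rw [Function.comp_apply, modular_T_smul, vadd_im]
      have h2 := h.comp hTt
      have h3 := h.const_mul (expTwoPi (1 / M) ^ (k + 1))
      have h4 : c = expTwoPi (1 / M) ^ (k + 1) * c := by
        refine tendsto_nhds_unique h2 (h3.congr fun τ => ?_)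
        simp only [Function.comp_apply, qRoot_T, hT, mul_pow, mul_assoc]
      by_contra hc0
      have h5 : expTwoPi (1 / M) ^ (k + 1) = 1 := by
        have := mul_right_cancel₀ hc0 ((one_mul c).trans h4)
        exact this.symm
      rw [← expTwoPi_natCast_mul, expTwoPi_eq_one_iff] at h5
      obtain ⟨n, hn⟩ := h5
      have hM' : (M : ℂ) ≠ 0 := by exact_mod_cast hM
      field_simp at hn
      have hn' : ((k + 1 : ℕ) : ℤ) = M * n := by exact_mod_cast hn
      exact hdvd (Int.natCast_dvd_natCast.1 ⟨n, hn'⟩)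

/-- The ring of holomorphic functions with an expansion at `i∞` with coefficients in `A`. -/
def expansionSubring (A : Subring ℂ) {M : ℕ} (hM : M ≠ 0) : Subring (ℍ → ℂ) where
  carrier := {f | MDiff f ∧ ∃ k, HasExpansion A M k f}
  mul_mem' := fun ⟨h1, _, hk⟩ ⟨h2, _, hl⟩ => ⟨h1.mul h2, _, hk.mul hM hl⟩
  one_mem' := ⟨mdifferentiable_const, 0, .const A.one_mem⟩
  add_mem' := fun ⟨h1, _, hk⟩ ⟨h2, _, hl⟩ => ⟨h1.add h2, _, hk.add hM hl⟩
  zero_mem' := ⟨mdifferentiable_const, 0, .const A.zero_mem⟩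
  neg_mem' := fun ⟨h1, _, hk⟩ => ⟨h1.neg, _, hk.neg⟩

/-- Precomposition with a self-map of the upper half-plane, as a ring homomorphism. -/
def precompHom (φ : ℍ → ℍ) : (ℍ → ℂ) →+* (ℍ → ℂ) where
  toFun f := f ∘ φ
  map_one' := rfl
  map_mul' _ _ := rfl
  map_zero' := rfl
  map_add' _ _ := rfl

/-- The monic polynomial `∏ (X - h i)` has `h i` as a root. Its coefficients are symmetric in the
family, hence invariant under `S` and `T`, and they keep holomorphy and expansions over `A`. -/
theorem isIntegral_of_permuted {ι : Type*} [Fintype ι] (hM : M ≠ 0) {R : Subring (ℍ → ℂ)}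
    (hR : modularJ ∈ R) (hA : ∀ c ∈ A, (fun _ => c) ∈ R) (h : ι → ℍ → ℂ)
    (hh : ∀ i, h i ∈ expansionSubring A hM) (s t : Equiv.Perm ι)
    (hs : ∀ i τ, h i (ModularGroup.S • τ) = h (s i) τ)
    (ht : ∀ i τ, h i (ModularGroup.T • τ) = h (t i) τ) (i : ι) : IsIntegral R (h i) := by
  set P : (ℍ → ℂ)[X] := ∏ i, (X - C (h i)) with hP
  have hlift : P ∈ Polynomial.lifts (expansionSubring A hM).subtype := by
    refine Subsemiring.prod_mem _ fun i _ => ?_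
    exact ⟨X - C ⟨h i, hh i⟩, by simp⟩
  have inv : ∀ (φ : ℍ → ℍ) (e : Equiv.Perm ι), (∀ i τ, h i (φ τ) = h (e i) τ) →
      P.map (precompHom φ) = P := fun φ e he => by
    rw [hP, Polynomial.map_prod]
    rw [← Equiv.prod_comp e (fun i => X - C (h i))]
    refine Finset.prod_congr rfl fun i _ => ?_
    rw [Polynomial.map_sub, map_X, map_C]
    congr 2
    ext τ
    exact he i τ
  have hcoeff : ∀ n, P.coeff n ∈ R := fun n => by
    obtain ⟨⟨x, hd, k, hk⟩, hx⟩ := (Polynomial.lifts_iff_coeff_lifts _).1 hlift n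
    simp only [Subring.coe_subtype] at hx
    subst hx
    have hinv : ∀ (φ : ℍ → ℍ) (e : Equiv.Perm ι), (∀ i τ, h i (φ τ) = h (e i) τ) →
        ∀ τ, P.coeff n (φ τ) = P.coeff n τ := fun φ e he τ => by
      have := congrArg (fun Q => Q.coeff n) (inv φ e he)
      simp only [coeff_map] at this
      exact congrFun this τ
    exact mem_of_invariant hM hR hA k _ hd (hinv _ s hs) (hinv _ t ht) hk
  have hl2 : P ∈ Polynomial.lifts R.subtype :=
    (Polynomial.lifts_iff_coeff_lifts _).2 fun n => ⟨⟨_, hcoeff n⟩, rfl⟩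
  have hmon : P.Monic := monic_prod_X_sub_C _ _
  obtain ⟨Q, hQ, -, hQm⟩ := Polynomial.lifts_and_degree_eq_and_monic hl2 hmon
  refine ⟨Q, hQm, ?_⟩
  change eval₂ R.subtype (h i) Q = 0
  rw [eval₂_eq_eval_map, hQ, hP, eval_prod]
  exact Finset.prod_eq_zero (Finset.mem_univ i) (by simp)

end expansion

/-! ### The powers `g_a ^ (12 * N)` and their integral expansions. -/

lemma mdifferentiable_siegelFunction (a : ℚ × ℚ) : MDiff (siegelFunction a) := by
  rw [mdifferentiable_iff]
  have hU : IsOpen {z : ℂ | 0 < z.im} := isOpen_upperHalfPlaneSet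
  have hE : ∀ f : ℂ → ℂ, Differentiable ℂ f → Differentiable ℂ fun z => expTwoPi (f z) :=
    fun f hf => differentiable_expTwoPi.comp hf
  have hQ : ∀ f : ℂ → ℂ, Differentiable ℂ f →
      DifferentiableOn ℂ (fun z => qProd (expTwoPi (f z)) (expTwoPi z)) {z : ℂ | 0 < z.im} :=
    fun f hf z hz => (differentiableAt_qProd (hU.mem_nhds hz) (hE f hf).differentiableOn
      differentiable_expTwoPi.differentiableOn (norm_expTwoPi_lt_one hz)).differentiableWithinAt
  refine DifferentiableOn.congr (f := fun z : ℂ =>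
    -expTwoPi ((bernoulliTwo a.1 / 2 : ℚ) * z) * expTwoPi ((a.2 : ℂ) * (a.1 - 1) / 2) *
      (qProd (expTwoPi (a.1 * z + a.2)) (expTwoPi z) *
        qProd (expTwoPi (z - (a.1 * z + a.2))) (expTwoPi z))) ?_ fun z hz => ?_
  · refine (DifferentiableOn.mul_const ?_ _).mul ((hQ _ (by fun_prop)).mul (hQ _ (by fun_prop)))
    exact (hE _ (by fun_prop)).neg.differentiableOn
  · rw [Function.comp_apply, siegelFunction_eq_qProd, ofComplex_apply_of_im_pos hz]

/-- The power `g_{(x/N, y/N)}^{12N}` of a Siegel function. -/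
noncomputable def siegelPow (N : ℕ) (x y : ℤ) (τ : ℍ) : ℂ :=
  siegelFunction ((x : ℚ) / N, (y : ℚ) / N) τ ^ (12 * N)

section siegelPow

variable {N : ℕ}

lemma siegelPow_S (x y : ℤ) (τ : ℍ) :
    siegelPow N x y (ModularGroup.S • τ) = siegelPow N y (-x) τ := by
  rw [siegelPow, siegelPow, pow_mul, pow_mul, siegelFunction_pow_twelve_S]
  push_cast
  rw [neg_div]

lemma siegelPow_T (x y : ℤ) (τ : ℍ) :
    siegelPow N x y (ModularGroup.T • τ) = siegelPow N x (x + y) τ := by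
  rw [siegelPow, siegelPow, pow_mul, pow_mul, siegelFunction_pow_twelve_T]
  push_cast
  rw [add_div]

/-- Translation multiplies the twelfth power by `e^{-2πi·6y/N}`, which the further `N`-th power
removes. -/
lemma siegelPow_add_fst (hN : N ≠ 0) (x y : ℤ) : siegelPow N (x + N) y = siegelPow N x y := by
  ext τ
  have hN' : (N : ℂ) ≠ 0 := by exact_mod_cast hN
  have hx : ((x + N : ℤ) : ℚ) / N = (x : ℚ) / N + 1 := by
    push_cast; rw [add_div, div_self (by exact_mod_cast hN)]
  have := siegelFunction_pow_twelve_add_fst ((x : ℚ) / N, (y : ℚ) / N) τ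
  simp only at this
  rw [siegelPow, siegelPow, pow_mul, pow_mul, hx, this, mul_pow, ← expTwoPi_natCast_mul,
    show (N : ℂ) * -(6 * ((y : ℚ) / N : ℚ)) = (-6 * y : ℤ) by push_cast; field_simp,
    expTwoPi_int, one_mul]

lemma siegelPow_add_snd (hN : N ≠ 0) (x y : ℤ) : siegelPow N x (y + N) = siegelPow N x y := by
  ext τ
  have hN' : (N : ℂ) ≠ 0 := by exact_mod_cast hN
  have hx : ((y + N : ℤ) : ℚ) / N = (y : ℚ) / N + 1 := by
    push_cast; rw [add_div, div_self (by exact_mod_cast hN)]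
  have := siegelFunction_pow_twelve_add_snd ((x : ℚ) / N, (y : ℚ) / N) τ
  simp only at this
  rw [siegelPow, siegelPow, pow_mul, pow_mul, hx, this, mul_pow, ← expTwoPi_natCast_mul,
    show (N : ℂ) * (6 * ((x : ℚ) / N : ℚ)) = (6 * x : ℤ) by push_cast; field_simp,
    expTwoPi_int, one_mul]

lemma siegelPow_congr (hN : N ≠ 0) {x x' y y' : ℤ} (hx : (x : ZMod N) = x')
    (hy : (y : ZMod N) = y') : siegelPow N x y = siegelPow N x' y' := by
  rw [ZMod.intCast_eq_intCast_iff_dvd_sub] at hx hy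
  obtain ⟨k, hk⟩ := hx
  obtain ⟨l, hl⟩ := hy
  have h1 : Function.Periodic (fun x => siegelPow N x y) (N : ℤ) := fun x =>
    siegelPow_add_fst hN x y
  have h2 : Function.Periodic (fun y => siegelPow N x' y) (N : ℤ) := siegelPow_add_snd hN x'
  have h3 := h1.int_mul k x
  have h4 := h2.int_mul l y
  simp only [Int.cast_id] at h3 h4
  rw [← h3, show x + k * N = x' by linarith, ← h4, show y + l * N = y' by linarith]

/-- The exponent of `q^{1/N}` is `N · 12N · B₂(x/N)/2`. The range `0 ≤ x ≤ N` leaves only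
nonnegative powers of `q^{1/N}` inside the products. -/
lemma siegelPow_eq (hN : N ≠ 0) {x : ℕ} (hx : x ≤ N) (y : ℤ) (τ : ℍ) : siegelPow N x y τ =
    expTwoPi ((6 * y * ((x : ℚ) / N - 1) : ℚ)) *
      (qRoot N τ ^ (6 * x ^ 2 - 6 * x * N + N ^ 2 : ℤ) *
        (qProd (expTwoPi (y / N : ℚ) * qRoot N τ ^ x) (qRoot N τ ^ N) ^ (12 * N) *
          qProd ((expTwoPi (y / N : ℚ))⁻¹ * qRoot N τ ^ (N - x)) (qRoot N τ ^ N) ^ (12 * N))) := by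
  have hN' : (N : ℂ) ≠ 0 := by exact_mod_cast hN
  have hz : ∀ e : ℤ, qRoot N τ ^ e = expTwoPi (e * (τ / N)) := fun e => by
    rw [qRoot, expTwoPi, expTwoPi, ← Complex.exp_int_mul]; congr 1; ring
  rw [siegelPow, siegelFunction_eq_qProd, qRoot_pow_self hN, mul_pow, mul_pow, mul_pow,
    Even.neg_pow (Even.mul_right (by decide) _), ← expTwoPi_natCast_mul, ← expTwoPi_natCast_mul,
    ← zpow_natCast (qRoot N τ), ← zpow_natCast (qRoot N τ), hz, hz, hz, Nat.cast_sub hx]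
  have e1 : ((12 * N : ℕ) : ℂ) * (((bernoulliTwo ((x : ℤ) / N : ℚ) / 2 : ℚ) : ℂ) * τ) =
      ((6 * x ^ 2 - 6 * x * N + N ^ 2 : ℤ) : ℂ) * (τ / N) := by
    simp only [bernoulliTwo]; push_cast; field_simp; ring
  have e2 : ((12 * N : ℕ) : ℂ) * (((y / N : ℚ) : ℂ) * (((x : ℤ) / N : ℚ) - 1) / 2) =
      ((6 * y * ((x : ℚ) / N - 1) : ℚ)) := by
    push_cast; field_simp; ring
  have e3 : ((((x : ℤ) : ℚ) / N : ℚ) : ℂ) * τ + (y / N : ℚ) =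
      (y / N : ℚ) + ((x : ℤ) : ℂ) * (τ / N) := by
    push_cast; ring
  have e4 : (τ : ℂ) - ((((x : ℤ) : ℚ) / N : ℚ) * τ + (y / N : ℚ)) =
      -(y / N : ℚ) + (((N : ℤ) - x : ℤ) : ℂ) * (τ / N) := by
    push_cast; field_simp; ring
  rw [e1, e2, e4, e3, expTwoPi_add, expTwoPi_add, expTwoPi_neg]
  ring

/-- The ring of algebraic integers in `ℂ`. -/
noncomputable def algInt : Subring ℂ := (integralClosure ℤ ℂ).toSubring

lemma mem_algInt {c : ℂ} : c ∈ algInt ↔ IsIntegral ℤ c := Iff.rfl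

lemma mem_algInt_of_pow_eq_one {c : ℂ} {n : ℕ} (hn : n ≠ 0) (h : c ^ n = 1) : c ∈ algInt :=
  IsIntegral.of_pow (Nat.pos_of_ne_zero hn) (h ▸ isIntegral_one)

lemma expTwoPi_rat_pow_den (r : ℚ) : expTwoPi r ^ r.den = 1 := by
  rw [← expTwoPi_natCast_mul, show ((r.den : ℂ) * (r : ℂ)) = (r.num : ℤ) by
    exact_mod_cast Rat.den_mul_eq_num r, expTwoPi_int]

lemma expTwoPi_rat_mem (r : ℚ) : expTwoPi r ∈ algInt :=
  mem_algInt_of_pow_eq_one r.den_nz (expTwoPi_rat_pow_den r)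

lemma expTwoPi_rat_inv_mem (r : ℚ) : (expTwoPi r)⁻¹ ∈ algInt :=
  mem_algInt_of_pow_eq_one r.den_nz (by rw [inv_pow, expTwoPi_rat_pow_den, inv_one])

lemma hasExpansion_zpow {A : Subring ℂ} (N : ℕ) (e : ℤ) :
    HasExpansion A N e.natAbs fun τ => qRoot N τ ^ e := by
  refine .of_eq (X ^ (e.natAbs + e).toNat) fun τ => ?_
  rw [eval₂_X_pow, ← zpow_natCast, ← zpow_natCast, ← zpow_add₀ (qRoot_ne_zero N τ),
    Int.toNat_of_nonneg (by omega)]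

lemma mdifferentiable_siegelPow (x y : ℤ) : MDiff (siegelPow N x y) :=
  (mdifferentiable_siegelFunction _).pow _

lemma siegelPow_mem (hN : N ≠ 0) {x : ℕ} (hx : x ≤ N) (y : ℤ) :
    siegelPow N x y ∈ expansionSubring algInt hN := by
  refine ⟨mdifferentiable_siegelPow _ _, ?_⟩
  have h := (HasExpansion.const (M := N) (expTwoPi_rat_mem (6 * y * ((x : ℚ) / N - 1)))).mul hN
    ((hasExpansion_zpow N (6 * x ^ 2 - 6 * x * N + N ^ 2 : ℤ)).mul hN
    (((hasExpansion_qProd hN (expTwoPi_rat_mem (y / N)) x).pow hN (12 * N)).mul hN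
      ((hasExpansion_qProd hN (expTwoPi_rat_inv_mem (y / N)) (N - x)).pow hN (12 * N))))
  exact ⟨_, (congrArg (HasExpansion algInt N _) (funext (siegelPow_eq hN hx y))).mpr h⟩

/-- Writing `ζ = ξ ^ i`, the quotient is the geometric sum `1 + ξ + ⋯ + ξ ^ (i - 1)`. -/
lemma one_sub_div_one_sub_mem {ζ ξ : ℂ} (hN : N ≠ 0) (hζ : IsPrimitiveRoot ζ N)
    (hξ : IsPrimitiveRoot ξ N) (h1 : ξ ≠ 1) : (1 - ζ) * (1 - ξ)⁻¹ ∈ algInt := by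
  have : NeZero N := ⟨hN⟩
  obtain ⟨i, -, rfl⟩ := hξ.eq_pow_of_pow_eq_one hζ.pow_eq_one
  have h2 : 1 - ξ ≠ 0 := sub_ne_zero.2 h1.symm
  rw [← mul_neg_geom_sum, mul_comm, inv_mul_cancel_left₀ h2]
  exact algInt.sum_mem fun j _ => algInt.pow_mem (mem_algInt_of_pow_eq_one hN hξ.pow_eq_one) _

lemma one_sub_mul_inv_siegelPow_mem (hN : N ≠ 0) {ζ : ℂ} (hζ : IsPrimitiveRoot ζ N)
    {x : ℕ} (hx : x < N) (y : ℤ) (h0 : x = 0 → IsPrimitiveRoot (expTwoPi (y / N : ℚ)) N)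
    (hN1 : N ≠ 1) (hne : ∀ τ, siegelPow N x y τ ≠ 0) :
    (fun τ => (1 - ζ) ^ (12 * N) * (siegelPow N x y τ)⁻¹) ∈ expansionSubring algInt hN := by
  refine ⟨by simpa only [div_eq_mul_inv] using!
    mdifferentiable_const.div (mdifferentiable_siegelPow _ _) hne, ?_⟩
  have hlim : ∀ (c : ℂ) {i : ℕ}, i ≠ 0 →
      Tendsto (fun τ => c * qRoot N τ ^ i) atImInfty (𝓝 0) := fun c i hi => by
    simpa [hi] using ((tendsto_qRoot hN).pow i).const_mul c
  have hinv : ∀ {c : ℂ}, c ∈ algInt → ∀ {i : ℕ}, i ≠ 0 → HasExpansion algInt N 0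
      (fun τ => qProd (c * qRoot N τ ^ i) (qRoot N τ ^ N))⁻¹ := fun hc i hi =>
    (hasExpansion_qProd hN hc i).inv hN one_ne_zero (by simp [algInt.one_mem])
      (tendsto_qProd_one hN (hlim _ hi))
  set u := expTwoPi (y / N : ℚ) with hu
  have hum : u ∈ algInt := expTwoPi_rat_mem _
  have h1 : HasExpansion algInt N 0
      (fun τ => (1 - ζ) * (qProd (u * qRoot N τ ^ x) (qRoot N τ ^ N))⁻¹) := by
    -- For `x = 0` the product begins with the constant `1 - u`, in general not a unit, and `1 - ζ`
    -- compensates for it. For `x > 0` the product has constant term `1`, and `1 - ζ` is merely an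
    -- integral constant.
    rcases Nat.eq_zero_or_pos x with rfl | hx0
    · have hu1 : u ≠ 1 := fun h => hN1 ((h0 rfl).eq_orderOf.trans (by rw [h, orderOf_one]))
      have := (HasExpansion.const (M := N) (one_sub_div_one_sub_mem hN hζ (h0 rfl) hu1)).mul hN
        (hinv hum hN)
      convert this using 1
      ext τ
      simp only [Pi.mul_apply, Pi.inv_apply]
      rw [pow_zero, mul_one, qProd_eq_mul u, mul_inv, mul_assoc]
      rw [norm_pow]
      exact pow_lt_one₀ (norm_nonneg _) (norm_qRoot_lt_one hN τ) hN
    · have hζA : 1 - ζ ∈ algInt :=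
        algInt.sub_mem algInt.one_mem (mem_algInt_of_pow_eq_one hN hζ.pow_eq_one)
      exact (HasExpansion.const (M := N) hζA).mul hN (hinv hum hx0.ne')
  have h := (HasExpansion.const (M := N)
    (expTwoPi_rat_inv_mem (6 * y * ((x : ℚ) / N - 1)))).mul hN
    ((hasExpansion_zpow N (-(6 * x ^ 2 - 6 * x * N + N ^ 2) : ℤ)).mul hN
    ((h1.pow hN (12 * N)).mul hN
      ((hinv (expTwoPi_rat_inv_mem (y / N)) (Nat.sub_ne_zero_of_lt hx)).pow hN (12 * N))))
  refine ⟨_, (congrArg (HasExpansion algInt N _) (funext fun τ => ?_)).mpr h⟩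
  simp only [Pi.mul_apply, Pi.inv_apply, Pi.pow_apply]
  rw [siegelPow_eq hN hx.le, zpow_neg, mul_pow, inv_pow, inv_pow, mul_inv, mul_inv, mul_inv]
  ring

end siegelPow

/-! ### Elements of exact order `N` in `(ℤ/N)²`. -/

lemma Rat.den_dvd_of_mul_eq_intCast {r : ℚ} {d : ℕ} (hd : d ≠ 0) {k : ℤ} (h : d * r = k) :
    r.den ∣ d := by
  have hr : r = ((k : ℤ) : ℚ) / ((d : ℤ) : ℚ) := by
    rw [← h]; push_cast; field_simp
  have := Rat.den_dvd k d
  rw [Rat.divInt_eq_div, ← hr] at this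
  exact Int.natCast_dvd_natCast.1 this

section orbit

variable {N : ℕ} [NeZero N]

/-- The pairs of exact order `N` in `(ℤ/N)²`. -/
abbrev ExactOrder (N : ℕ) : Type := {b : ZMod N × ZMod N // addOrderOf b = N}

/-- The action of `S` on `(ℤ/N)²`. -/
def rotateEquiv (N : ℕ) : (ZMod N × ZMod N) ≃+ (ZMod N × ZMod N) where
  toFun b := (b.2, -b.1)
  invFun b := (-b.2, b.1)
  left_inv b := by simp
  right_inv b := by simp
  map_add' b c := by simp [add_comm]

/-- The action of `T` on `(ℤ/N)²`. -/
def shearEquiv (N : ℕ) : (ZMod N × ZMod N) ≃+ (ZMod N × ZMod N) where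
  toFun b := (b.1, b.1 + b.2)
  invFun b := (b.1, b.2 - b.1)
  left_inv b := by simp
  right_inv b := by simp
  map_add' b c := by ext <;> simp; abel

/-- The permutation of the pairs of exact order `N` given by an automorphism. -/
def exactOrderPerm (e : (ZMod N × ZMod N) ≃+ (ZMod N × ZMod N)) : Equiv.Perm (ExactOrder N) :=
  e.toEquiv.subtypeEquiv fun b => by simp [AddEquiv.addOrderOf_eq]

/-- The function `g_b^{12N}` attached to a class `b` in `(ℤ/N)²`. -/
noncomputable def siegelClass (b : ZMod N × ZMod N) : ℍ → ℂ := siegelPow N b.1.val b.2.val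

lemma siegelClass_S (b : ZMod N × ZMod N) (τ : ℍ) :
    siegelClass b (ModularGroup.S • τ) = siegelClass (rotateEquiv N b) τ := by
  rw [siegelClass, siegelPow_S, siegelClass]
  refine congrFun (siegelPow_congr (NeZero.ne N) ?_ ?_) τ <;> simp [rotateEquiv]

lemma siegelClass_T (b : ZMod N × ZMod N) (τ : ℍ) :
    siegelClass b (ModularGroup.T • τ) = siegelClass (shearEquiv N b) τ := by
  rw [siegelClass, siegelPow_T, siegelClass]
  refine congrFun (siegelPow_congr (NeZero.ne N) ?_ ?_) τ <;> simp [shearEquiv]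

/-- When the first coordinate vanishes, the second alone has order `N`, so its representative is
coprime to `N`. This is why the family is restricted to exact order `N`. -/
lemma isPrimitiveRoot_expTwoPi_of_addOrderOf {b : ZMod N × ZMod N} (hb : addOrderOf b = N)
    (h0 : b.1.val = 0) : IsPrimitiveRoot (expTwoPi ((b.2.val : ℤ) / N : ℚ)) N := by
  have h1 : b.1 = 0 := (ZMod.val_eq_zero _).1 h0
  have h2 : addOrderOf b.2 = N := by
    have := Prod.addOrderOf b
    rw [hb, h1, addOrderOf_zero, Nat.lcm_one_left] at this
    exact this.symm
  have hcop : b.2.val.Coprime N := by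
    have h3 := ZMod.addOrderOf_coe b.2.val (NeZero.ne N)
    rw [ZMod.natCast_zmod_val, h2] at h3
    rcases Nat.div_eq_self.1 h3.symm with h4 | h4
    · exact absurd h4 (NeZero.ne N)
    · exact Nat.coprime_comm.1 h4
  have := Complex.isPrimitiveRoot_exp_of_coprime b.2.val N (NeZero.ne N) hcop
  convert this using 1
  rw [expTwoPi]; push_cast; rfl

lemma siegelClass_ne_zero {b : ZMod N × ZMod N} (hN1 : N ≠ 1) (hb : addOrderOf b = N) (τ : ℍ) :
    siegelClass b τ ≠ 0 := by
  refine pow_ne_zero _ (siegelFunction_ne_zero ?_ τ)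
  rintro ⟨⟨m, n⟩, hmn⟩
  have hNQ : (N : ℚ) ≠ 0 := by exact_mod_cast NeZero.ne N
  have key : ∀ (c : ZMod N) (m : ℤ), ((c.val : ℤ) : ℚ) / N = m → c = 0 := fun c m h => by
    rw [div_eq_iff hNQ] at h
    have h2 : (c.val : ℤ) = m * N := by exact_mod_cast h
    have h3 := congrArg (Int.cast : ℤ → ZMod N) h2
    simpa using h3
  have hb0 : b = 0 := Prod.ext (key _ m (congrArg Prod.fst hmn)) (key _ n (congrArg Prod.snd hmn))
  rw [hb0, addOrderOf_zero] at hb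
  exact hN1 hb.symm

/-- If `d` is the order, then `d·x/N` and `d·y/N` are integers, so both denominators divide `d`, and
with them their least common multiple. -/
lemma addOrderOf_intCast_pair {x y : ℤ} (h : N ∣ Nat.lcm ((x : ℚ) / N).den ((y : ℚ) / N).den) :
    addOrderOf ((x : ZMod N), (y : ZMod N)) = N := by
  have hNQ : (N : ℚ) ≠ 0 := by exact_mod_cast NeZero.ne N
  have hNb : N • ((x : ZMod N), (y : ZMod N)) = 0 := by ext <;> simp
  have hd0 : addOrderOf ((x : ZMod N), (y : ZMod N)) ≠ 0 := fun h0 =>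
    NeZero.ne N (by simpa [h0] using addOrderOf_dvd_iff_nsmul_eq_zero.2 hNb)
  refine Nat.dvd_antisymm (addOrderOf_dvd_iff_nsmul_eq_zero.2 hNb) (h.trans ?_)
  have hd := addOrderOf_nsmul_eq_zero ((x : ZMod N), (y : ZMod N))
  set d := addOrderOf ((x : ZMod N), (y : ZMod N))
  have key : ∀ z : ℤ, d • (z : ZMod N) = 0 → ((z : ℚ) / N).den ∣ d := fun z hz => by
    have h1 : ((d * z : ℤ) : ZMod N) = 0 := by simpa using hz
    obtain ⟨k, hk⟩ := (ZMod.intCast_zmod_eq_zero_iff_dvd _ N).1 h1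
    refine Rat.den_dvd_of_mul_eq_intCast hd0 (k := k) ?_
    have h2 : (d : ℚ) * z = N * k := by exact_mod_cast hk
    field_simp
    linarith
  exact Nat.lcm_dvd (key x (congrArg Prod.fst hd)) (key y (congrArg Prod.snd hd))

end orbit

/-! ### Descent to `ℤ[j]` and conclusion. -/

lemma Rat.exists_eq_div_of_den_dvd {r : ℚ} {N : ℕ} (hN : N ≠ 0) (h : r.den ∣ N) :
    ∃ x : ℤ, r = x / N := by
  obtain ⟨k, rfl⟩ := h
  refine ⟨r.num * k, ?_⟩
  have hk : (k : ℚ) ≠ 0 := by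
    rintro hk
    exact hN (by simp [Nat.cast_eq_zero.1 hk])
  push_cast
  rw [mul_div_mul_right _ _ hk, Rat.num_div_den]

/-- The coefficient ring is taken to be the integral closure of `ℤ[j]` in all functions: it contains
`j` and the constant algebraic integers, and integrality over it descends to `ℤ[j]` by transitivity.
-/
lemma isIntegral_of_expansion {ι : Type*} [Fintype ι] {M : ℕ} (hM : M ≠ 0) (h : ι → ℍ → ℂ)
    (hh : ∀ i, h i ∈ expansionSubring algInt hM) (s t : Equiv.Perm ι)
    (hs : ∀ i τ, h i (ModularGroup.S • τ) = h (s i) τ)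
    (ht : ∀ i τ, h i (ModularGroup.T • τ) = h (t i) τ) (i : ι) : IsIntegral intAdjoinJ (h i) := by
  have hJ : modularJ ∈ (integralClosure intAdjoinJ (ℍ → ℂ)).toSubring :=
    isIntegral_algebraMap (R := intAdjoinJ) (x := ⟨modularJ, Algebra.self_mem_adjoin_singleton _ _⟩)
  have hA : ∀ c ∈ algInt, (fun _ => c) ∈ (integralClosure intAdjoinJ (ℍ → ℂ)).toSubring :=
    fun c hc => (IsIntegral.map (Pi.constRingHom ℍ ℂ).toIntAlgHom (mem_algInt.1 hc)).tower_top
  have := isIntegral_of_permuted hM hJ hA h hh s t hs ht i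
  exact isIntegral_trans (A := integralClosure intAdjoinJ (ℍ → ℂ)) _ this

theorem proposition2p2 (a : ℚ × ℚ) (ha : ¬ ∃ m : ℤ × ℤ, a = ((m.1 : ℚ), (m.2 : ℚ)))
    (ζ : ℂ) (hζ : IsPrimitiveRoot ζ (pairDenom a)) :
    IsIntegral intAdjoinJ (siegelFunction a) ∧
      IsIntegral intAdjoinJ (fun τ : ℍ => (1 - ζ) * (siegelFunction a τ)⁻¹) := by
  have hN : pairDenom a ≠ 0 := Nat.lcm_ne_zero a.1.den_nz a.2.den_nz
  have hN1 : pairDenom a ≠ 1 := fun h => by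
    obtain ⟨h1, h2⟩ : a.1.den = 1 ∧ a.2.den = 1 :=
      ⟨Nat.dvd_one.1 (h ▸ Nat.dvd_lcm_left _ _), Nat.dvd_one.1 (h ▸ Nat.dvd_lcm_right _ _)⟩
    exact ha ⟨(a.1.num, a.2.num), Prod.ext (Rat.den_eq_one_iff _ |>.1 h1).symm
      (Rat.den_eq_one_iff _ |>.1 h2).symm⟩
  obtain ⟨x, hx⟩ := Rat.exists_eq_div_of_den_dvd hN (Nat.dvd_lcm_left a.1.den a.2.den)
  obtain ⟨y, hy⟩ := Rat.exists_eq_div_of_den_dvd hN (Nat.dvd_lcm_right a.1.den a.2.den)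
  have hlcm : pairDenom a = Nat.lcm a.1.den a.2.den := rfl
  generalize pairDenom a = N at *
  have : NeZero N := ⟨hN⟩
  have hb : addOrderOf ((x : ZMod N), (y : ZMod N)) = N :=
    addOrderOf_intCast_pair (by rw [← hx, ← hy, ← hlcm])
  -- The member of the family at the class of `(x, y)` is computed from reduced representatives;
  -- periodicity in `a` identifies it with the power of `g_a` itself.
  have hpow : siegelClass ((x : ZMod N), (y : ZMod N)) = siegelFunction a ^ (12 * N) := by
    rw [siegelClass, siegelPow_congr hN (x' := x) (y' := y) (by simp) (by simp)]
    ext τ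
    rw [siegelPow, ← hx, ← hy]; rfl
  have h12 : 0 < 12 * N := by positivity
  let i : ExactOrder N := ⟨_, hb⟩
  constructor
  · refine IsIntegral.of_pow h12 (hpow ▸ ?_)
    exact isIntegral_of_expansion hN (fun b : ExactOrder N => siegelClass b.1)
      (fun b => siegelPow_mem hN (ZMod.val_lt _).le _) (exactOrderPerm (rotateEquiv N))
      (exactOrderPerm (shearEquiv N)) (fun b τ => siegelClass_S _ _) (fun b τ => siegelClass_T _ _) i
  · refine IsIntegral.of_pow h12 ?_
    have := isIntegral_of_expansion hN
      (fun (b : ExactOrder N) τ => (1 - ζ) ^ (12 * N) * (siegelClass b.1 τ)⁻¹)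
      (fun b => one_sub_mul_inv_siegelPow_mem hN hζ (ZMod.val_lt _) _
        (isPrimitiveRoot_expTwoPi_of_addOrderOf b.2) hN1 (siegelClass_ne_zero hN1 b.2))
      (exactOrderPerm (rotateEquiv N)) (exactOrderPerm (shearEquiv N))
      (fun b τ => by rw [siegelClass_S]; rfl) (fun b τ => by rw [siegelClass_T]; rfl) i
    convert this using 1
    ext τ
    simp only [i, hpow, Pi.pow_apply]
    rw [mul_pow, inv_pow]
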